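/- \textbf{Theorem (Risk of Support Vector Regression).} Let $\mathcal X$ be a measurable space endowed with an arbitrary total ordering, $\mathcal H$ a real Hilbert space, $\varphi:\mathcal X\to\mathcal H$ a feature map whose kernel $(x,x')\mapsto\langle\varphi(x),\varphi(x')\rangle$ is measurable, $\rho>0$ and $t\ge 0$. Examples are pairs $(x,y)\in\mathcal X\times\mathbb R$. For a finite multiset $S$ of examples $(x_1,y_1),\dots,(x_n,y_n)$, let $(w^*(S),b^*(S))$ be given by the solution of $$\min_{w\in\mathcal H,\ b\in\mathbb R,\ \xi_1,\dots,\xi_n\ge 0}\ \|w\|^2+\rho\sum_{i=1}^n\xi_i\quad\text{subject to}\quad |y_i-\langle w,\varphi(x_i)\rangle-b|\le t+\xi_i,\quad i=1,\dots,n,$$ where, if $b$ is not unique, the minimizer with the smallest $|b|$ is taken. Let $\mathcal A_{\mathrm{SVR}}(S)$ be the predictor $x\mapsto\langle w^*(S),\varphi(x)\rangle+b^*(S)$. Let $\mathsf c_{\mathrm{SVR}}(S)=S_+\cup S_0$ (multiplicities are added), where $S_+$ consists of all examples of $S$, with their multiplicities, for which $|y_i-\langle w^*(S),\varphi(x_i)\rangle-b^*(S)|>t$,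 and $S_0$ is a sub-multiset of $S$ of smallest cardinality among those that contain only examples with $|y_i-\langle w^*(S),\varphi(x_i)\rangle-b^*(S)|=t$ and satisfy $w^*(S_+\cup S_0)=w^*(S)$ and $b^*(S_+\cup S_0)=b^*(S)$. If several such multisets exist, the one whose increasingly ordered list of instances is lexicographically smallest is chosen (any remaining tie being broken in the same way by the increasing list of the examples $(x,y)$ in lexicographic order). Let $D$ be a probability distribution on $\mathcal X\times\mathbb R$, let $\mathbf S$ be the multiset of $N$ independent random examples, each with distribution $D$, and for a predictor $h$ let $\mathsf R(h)=D\{(x,y):|y-h(x)|>t\}$. For $\delta\in(0,1)$ and $k=0,\dots,N-1$ let $\epsilon_k$ be the unique solution $\alpha\in(0,1)$ of $$\frac{\delta}{N}\sum_{m=k}^{N-1}\frac{\binom mk}{\binom Nk}(1-\alpha)^{-(N-m)}=1,$$ and let $\epsilon_N=1$. Then, for every $\delta\in(0,1)$, $$\Pr\big\{\mathsf R(\mathcal A_{\mathrm{SVR}}(\mathbf S))>\epsilon_{\mathbf k}\big\}\le\delta,\qquad\text{where }\mathbf k=|\mathsf c_{\mathrm{SVR}}(\mathbf S)|.$$ 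-/

import Mathlib

open MeasureTheory ProbabilityTheory

noncomputable section

namespace SVR

section Program

variable {X H : Type*} [NormedAddCommGroup H] [InnerProductSpace ℝ H]

/-- Residual `y - ⟨w, φ x⟩ - b` of the affine predictor `(w, b)` on the example `z = (x, y)`. -/
def residual (φ : X → H) (w : H) (b : ℝ) (z : X × ℝ) : ℝ :=
  z.2 - inner ℝ w (φ z.1) - b

open scoped Classical in
/-- Feasible points `(w, b, ξ)` of the program on the training multiset `S`. There is one slack
variable for each element of `S`, repetitions included: the coercion of `S` to a type consists of
the pairs of an element of `S` and a number below its multiplicity. -/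
def IsFeasible (φ : X → H) (t : ℝ) (S : Multiset (X × ℝ)) (w : H) (b : ℝ) (ξ : S → ℝ) : Prop :=
  ∀ i : S, 0 ≤ ξ i ∧ |residual φ w b i.1| ≤ t + ξ i

open scoped Classical in
/-- The cost `‖w‖² + ρ ∑ ξᵢ`. -/
def cost (ρ : ℝ) (S : Multiset (X × ℝ)) (w : H) (ξ : S → ℝ) : ℝ :=
  ‖w‖ ^ 2 + ρ * ∑ i : S, ξ i

open scoped Classical in
/-- `(w, b)` together with some slack variables is a minimizer of the program on `S`. -/
def IsMinimizer (φ : X → H) (ρ t : ℝ) (S : Multiset (X × ℝ)) (p : H × ℝ) : Prop :=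
  ∃ ξ : S → ℝ, IsFeasible φ t S p.1 p.2 ξ ∧
    ∀ (w : H) (b : ℝ) (ξ' : S → ℝ), IsFeasible φ t S w b ξ' → cost ρ S p.1 ξ ≤ cost ρ S w ξ'

/-- A minimizer with the smallest `|b|` among all minimizers. -/
def IsSolution (φ : X → H) (ρ t : ℝ) (S : Multiset (X × ℝ)) (p : H × ℝ) : Prop :=
  IsMinimizer φ ρ t S p ∧ ∀ q : H × ℝ, IsMinimizer φ ρ t S q → |p.2| ≤ |q.2|

/-- The solution `(w*(S), b*(S))`. -/
def solution (φ : X → H) (ρ t : ℝ) (S : Multiset (X × ℝ)) : H × ℝ :=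
  Classical.epsilon (IsSolution φ ρ t S)

/-- The learning algorithm: the predictor `x ↦ ⟨w*(S), φ x⟩ + b*(S)`. -/
def predictor (φ : X → H) (ρ t : ℝ) (S : Multiset (X × ℝ)) (x : X) : ℝ :=
  inner ℝ (solution φ ρ t S).1 (φ x) + (solution φ ρ t S).2

/-- Residual of the example `z` at the solution for `S`. -/
def solResidual (φ : X → H) (ρ t : ℝ) (S : Multiset (X × ℝ)) (z : X × ℝ) : ℝ :=
  residual φ (solution φ ρ t S).1 (solution φ ρ t S).2 z

open scoped Classical in
/-- `S₊`: the examples of `S`, with their multiplicities, whose residual exceeds `t`. -/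
def plusPart (φ : X → H) (ρ t : ℝ) (S : Multiset (X × ℝ)) : Multiset (X × ℝ) :=
  S.filter fun z => t < |solResidual φ ρ t S z|

/-- The sub-multisets `T` of `S` of examples with residual exactly `t` in absolute value, such
that `S₊ ∪ T` has the same solution as `S`. -/
def IsCandidate (φ : X → H) (ρ t : ℝ) (S T : Multiset (X × ℝ)) : Prop :=
  T ≤ S ∧ (∀ z ∈ T, |solResidual φ ρ t S z| = t) ∧
    solution φ ρ t (plusPart φ ρ t S + T) = solution φ ρ t S

end Program

section Compression

variable {X H : Type*} [LinearOrder X] [NormedAddCommGroup H] [InnerProductSpace ℝ H]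

/-- Key by which multisets of examples are ordered: the increasing list of the instances,
compared lexicographically (smallest instance first, then the second smallest, and so on); if all
instances coincide, the labels decide, through the increasing list of the examples. -/
def orderKey (T : Multiset (X × ℝ)) : List X ×ₗ List (X ×ₗ ℝ) :=
  toLex ((T.map Prod.fst).sort (· ≤ ·), (T.map toLex).sort (· ≤ ·))

/-- `T` is the chosen multiset `S₀`: a candidate of smallest cardinality and, among those, the
first one in the order. -/
def IsZeroPart (φ : X → H) (ρ t : ℝ) (S T : Multiset (X × ℝ)) : Prop :=
  IsCandidate φ ρ t S T ∧
    ∀ T', IsCandidate φ ρ t S T' →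
      T.card < T'.card ∨ (T.card = T'.card ∧ orderKey T ≤ orderKey T')

/-- `S₀`. -/
def zeroPart (φ : X → H) (ρ t : ℝ) (S : Multiset (X × ℝ)) : Multiset (X × ℝ) :=
  Classical.epsilon (IsZeroPart φ ρ t S)

/-- The compression function `S ↦ S₊ ∪ S₀` (union of multisets adds multiplicities). -/
def compression (φ : X → H) (ρ t : ℝ) (S : Multiset (X × ℝ)) : Multiset (X × ℝ) :=
  plusPart φ ρ t S + zeroPart φ ρ t S

end Compression

section Risk

variable {X : Type*}

open scoped Classical in
/-- The loss: `1` if the prediction misses the label by more than `t`, and `0` otherwise. -/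
def loss (t : ℝ) (h : X → ℝ) (z : X × ℝ) : ℕ :=
  if t < |z.2 - h z.1| then 1 else 0

/-- The risk of a predictor when examples have distribution `D`. -/
def risk [MeasurableSpace X] (D : Measure (X × ℝ)) (t : ℝ) (h : X → ℝ) : ℝ :=
  D.real {z | loss t h z = 1}

end Risk

/-- `Ψ_{k,δ}(α) = (δ / N) ∑_{m=k}^{N-1} (m choose k) / (N choose k) (1-α)^{-(N-m)}`. -/
def Psi (N : ℕ) (δ : ℝ) (k : ℕ) (α : ℝ) : ℝ :=
  δ / N * ∑ m ∈ Finset.Ico k N,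
    (m.choose k : ℝ) / (N.choose k : ℝ) * ((1 - α) ^ (N - m))⁻¹

/-- `ε_k` for `k ≤ N`: the solution in `(0, 1)` of `Ψ_{k,δ}(α) = 1` if `k < N`, and `1` if
`k = N`. -/
def eps (N : ℕ) (δ : ℝ) (k : ℕ) : ℝ :=
  if k < N then Classical.epsilon fun α : ℝ => α ∈ Set.Ioo 0 1 ∧ Psi N δ k α = 1 else 1

end SVR

end

/-! The solution is insensitive to well-fitted examples: adding examples with residual at most `t`,
or removing examples with residual below `t`, leaves it unchanged (`IsSolution.add`,
`IsSolution.of_add`). Both follow from convexity of the objective, which is strong in `w`.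

Index the sample by `N` positions and call `I ⊆ J` optimal for `J` if it encodes a compression of
least size. If `I` is optimal for `J'` and `I ⊆ J ⊆ J'`, then `I` is optimal for `J`, and every
optimal set for `J` is optimal for `J'`. Hence the uniform weight of `I` among the optimal sets can
only grow from `J'` to `J` (`weight_le_of_subset`). Moreover, the examples of `J'` outside `I` must
be fitted by the solution for `I`. Let `a` be the probability that this solution fits a fresh
example, that is, one minus its risk. Integrating out the positions outside `J` one by one gives
`E[weight(univ, I) h(a)] ≤ E[weight(J, I) h(a) a^(N - |J|)]` (`lintegral_weight_union_le`).

If the risk exceeds `ε_k`, `k = |I|`, then `1 ≤ Ψ`, a combination of the powers `a^(-(N-m))`. Its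
coefficients are `(δ/N) / (N choose m)` times the number of `m`-sets `J ⊇ I`. Taking `h(a) =
a^(-(N-m))` on that event cancels the powers and leaves averages over `J` of `E[weight(J, I)]`. For
fixed `J` the weights sum to 1, so summing over `I` yields at most `δ/N` for each of the `N` values
of `m`. All optimal sets for the whole sample share size and solution, so the total weight on the
bad event is at least its indicator. -/

namespace SVR

/-! ### Convexity, existence and uniqueness of the solution -/

section Optimization

open Filter Topology

variable {X H : Type*} [NormedAddCommGroup H] [InnerProductSpace ℝ H]

/-- The smallest slack that makes `p = (w, b)` feasible on the example `z`. -/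
noncomputable def excess (φ : X → H) (t : ℝ) (p : H × ℝ) (z : X × ℝ) : ℝ :=
  max 0 (|residual φ p.1 p.2 z| - t)

/-- The cost of `p = (w, b)` when the slack variables are chosen optimally. -/
noncomputable def objective (φ : X → H) (ρ t : ℝ) (S : Multiset (X × ℝ)) (p : H × ℝ) : ℝ :=
  ‖p.1‖ ^ 2 + ρ * (S.map (excess φ t p)).sum

variable {φ : X → H} {ρ t : ℝ} {S T U : Multiset (X × ℝ)} {p q : H × ℝ}

lemma excess_nonneg (z : X × ℝ) : 0 ≤ excess φ t p z := le_max_left _ _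

lemma excess_eq_zero {z : X × ℝ} (h : |residual φ p.1 p.2 z| ≤ t) : excess φ t p z = 0 :=
  max_eq_left (by linarith)

lemma sum_excess_nonneg : 0 ≤ (S.map (excess φ t p)).sum :=
  Multiset.sum_nonneg fun x hx => by
    obtain ⟨z, -, rfl⟩ := Multiset.mem_map.1 hx
    exact excess_nonneg z

lemma sum_excess_eq_zero (h : ∀ z ∈ S, |residual φ p.1 p.2 z| ≤ t) :
    (S.map (excess φ t p)).sum = 0 := by
  refine Multiset.sum_eq_zero fun x hx => ?_
  obtain ⟨z, hz, rfl⟩ := Multiset.mem_map.1 hx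
  exact excess_eq_zero (h z hz)

lemma sum_coe_eq_sum_map {α : Type*} [DecidableEq α] (S : Multiset α) (f : α → ℝ) :
    ∑ i : S, f i.1 = (S.map f).sum := by
  rw [Finset.sum, Multiset.map_univ]

open scoped Classical in
lemma objective_le_cost (hρ : 0 < ρ) {ξ : S → ℝ} (h : IsFeasible φ t S p.1 p.2 ξ) :
    objective φ ρ t S p ≤ cost ρ S p.1 ξ := by
  unfold objective cost
  rw [← sum_coe_eq_sum_map]
  refine add_le_add_right (mul_le_mul_of_nonneg_left (Finset.sum_le_sum fun i _ => ?_) hρ.le) _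
  exact max_le (h i).1 (by linarith [(h i).2])

open scoped Classical in
lemma isFeasible_excess (p : H × ℝ) :
    IsFeasible φ t S p.1 p.2 (fun i => excess φ t p i.1) := fun i =>
  ⟨excess_nonneg _, by
    have := le_max_right 0 (|residual φ p.1 p.2 i.1| - t)
    unfold excess
    linarith⟩

open scoped Classical in
lemma cost_excess (p : H × ℝ) :
    cost ρ S p.1 (fun i => excess φ t p i.1) = objective φ ρ t S p := by
  simp only [objective, cost, ← sum_coe_eq_sum_map]

lemma isMinimizer_iff (hρ : 0 < ρ) :
    IsMinimizer φ ρ t S p ↔ ∀ q, objective φ ρ t S p ≤ objective φ ρ t S q := by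
  constructor
  · rintro ⟨ξ, hξ, hmin⟩ q
    rw [← cost_excess q]
    exact (objective_le_cost hρ hξ).trans (hmin _ _ _ (isFeasible_excess q))
  · intro h
    refine ⟨_, isFeasible_excess p, fun w b ξ' hξ' => ?_⟩
    rw [cost_excess]
    exact (h (w, b)).trans (objective_le_cost hρ hξ')

lemma objective_add :
    objective φ ρ t (S + T) p = objective φ ρ t S p + ρ * (T.map (excess φ t p)).sum := by
  simp only [objective, Multiset.map_add, Multiset.sum_add]
  ring

lemma residual_segment (s : ℝ) (p q : H × ℝ) (z : X × ℝ) :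
    residual φ ((1 - s) • p + s • q).1 ((1 - s) • p + s • q).2 z =
      (1 - s) * residual φ p.1 p.2 z + s * residual φ q.1 q.2 z := by
  simp only [residual, Prod.fst_add, Prod.snd_add, Prod.smul_fst, Prod.smul_snd, inner_add_left,
    real_inner_smul_left, smul_eq_mul]
  ring

lemma excess_segment {s : ℝ} (h0 : 0 ≤ s) (h1 : s ≤ 1) (p q : H × ℝ) (z : X × ℝ) :
    excess φ t ((1 - s) • p + s • q) z ≤ (1 - s) * excess φ t p z + s * excess φ t q z := by
  have hp := le_max_right 0 (|residual φ p.1 p.2 z| - t)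
  have hq := le_max_right 0 (|residual φ q.1 q.2 z| - t)
  have hs : 0 ≤ 1 - s := by linarith
  refine max_le (add_nonneg (mul_nonneg hs (excess_nonneg _)) (mul_nonneg h0 (excess_nonneg _))) ?_
  rw [residual_segment]
  have h := abs_add_le ((1 - s) * residual φ p.1 p.2 z) (s * residual φ q.1 q.2 z)
  rw [abs_mul, abs_mul, abs_of_nonneg hs, abs_of_nonneg h0] at h
  have h2 := mul_le_mul_of_nonneg_left hp hs
  have h3 := mul_le_mul_of_nonneg_left hq h0
  unfold excess
  linarith

lemma norm_segment_sq (s : ℝ) (v w : H) :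
    ‖(1 - s) • v + s • w‖ ^ 2 =
      (1 - s) * ‖v‖ ^ 2 + s * ‖w‖ ^ 2 - s * (1 - s) * ‖v - w‖ ^ 2 := by
  rw [norm_add_sq_real, norm_sub_sq_real, norm_smul, norm_smul, real_inner_smul_left,
    real_inner_smul_right, mul_pow, mul_pow, Real.norm_eq_abs, Real.norm_eq_abs, sq_abs, sq_abs]
  ring

/-- Strong convexity of the objective in the direction of `w`. -/
lemma objective_segment (hρ : 0 < ρ) {s : ℝ} (h0 : 0 ≤ s) (h1 : s ≤ 1) (p q : H × ℝ) :
    objective φ ρ t S ((1 - s) • p + s • q) ≤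
      (1 - s) * objective φ ρ t S p + s * objective φ ρ t S q -
        s * (1 - s) * ‖p.1 - q.1‖ ^ 2 := by
  have key : (S.map (excess φ t ((1 - s) • p + s • q))).sum ≤
      (1 - s) * (S.map (excess φ t p)).sum + s * (S.map (excess φ t q)).sum := by
    rw [← Multiset.sum_map_mul_left, ← Multiset.sum_map_mul_left, ← Multiset.sum_map_add]
    exact Multiset.sum_map_le_sum_map _ _ fun z _ => excess_segment h0 h1 p q z
  have hn := norm_segment_sq s p.1 q.1
  have h2 := mul_le_mul_of_nonneg_left key hρ.le
  simp only [objective, Prod.fst_add, Prod.smul_fst] at *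
  rw [hn]
  linarith

/-- Compare `p` with the midpoint of `p` and `q`. This quadratic growth gives both uniqueness of `w`
and convergence of near-minimizers. -/
lemma norm_sub_sq_le (hρ : 0 < ρ) (hp : ∀ q, objective φ ρ t S p ≤ objective φ ρ t S q)
    (q : H × ℝ) : ‖p.1 - q.1‖ ^ 2 ≤ 2 * (objective φ ρ t S q - objective φ ρ t S p) := by
  have h := objective_segment (φ := φ) (t := t) (S := S) hρ (s := 1 / 2) (by norm_num)
    (by norm_num) p q
  have h2 := hp ((1 - (1 / 2 : ℝ)) • p + (1 / 2 : ℝ) • q)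
  linarith

lemma IsMinimizer.fst_eq (hρ : 0 < ρ) (hp : IsMinimizer φ ρ t S p) (hq : IsMinimizer φ ρ t S q) :
    p.1 = q.1 := by
  rw [isMinimizer_iff hρ] at hp hq
  have h := norm_sub_sq_le hρ hp q
  have h2 : ‖p.1 - q.1‖ ^ 2 ≤ 0 := by linarith [hq p]
  rw [← sub_eq_zero, ← norm_eq_zero]
  exact pow_eq_zero_iff two_ne_zero |>.1 (le_antisymm h2 (sq_nonneg _))

lemma IsMinimizer.segment (hρ : 0 < ρ) (hp : IsMinimizer φ ρ t S p) (hq : IsMinimizer φ ρ t S q)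
    {s : ℝ} (h0 : 0 ≤ s) (h1 : s ≤ 1) : IsMinimizer φ ρ t S ((1 - s) • p + s • q) := by
  rw [isMinimizer_iff hρ] at hp hq ⊢
  intro r
  have h := objective_segment (φ := φ) (t := t) (S := S) hρ h0 h1 p q
  have h2 : objective φ ρ t S q = objective φ ρ t S p := le_antisymm (hq p) (hp q)
  have h3 : 0 ≤ s * (1 - s) * ‖p.1 - q.1‖ ^ 2 := by
    have : 0 ≤ 1 - s := by linarith
    positivity
  rw [h2] at h
  linarith [hp r]

/-- If the offsets were opposite, the midpoint would be a minimizer with offset 0, so both would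
vanish. -/
lemma IsSolution.unique (hρ : 0 < ρ) (hp : IsSolution φ ρ t S p) (hq : IsSolution φ ρ t S q) :
    p = q := by
  have hw := hp.1.fst_eq hρ hq.1
  have hb : |p.2| = |q.2| := le_antisymm (hp.2 q hq.1) (hq.2 p hp.1)
  refine Prod.ext hw ?_
  rcases abs_eq_abs.1 hb with h | h
  · exact h
  · have hm := hp.2 _ (hp.1.segment hρ hq.1 (s := 1 / 2) (by norm_num) (by norm_num))
    simp only [Prod.snd_add, Prod.smul_snd, smul_eq_mul, h] at hm
    have : (1 - 1 / 2) * -q.2 + 1 / 2 * q.2 = 0 := by ring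
    rw [this, abs_zero, abs_nonpos_iff] at hm
    linarith

lemma continuous_objective : Continuous (objective φ ρ t S) := by
  unfold objective
  refine (by fun_prop : Continuous fun p : H × ℝ => ‖p.1‖ ^ 2).add (continuous_const.mul ?_)
  refine continuous_multiset_sum S fun z _ => ?_
  unfold excess residual
  fun_prop

/-- Adding examples with residual at most `t` does not change the solution. -/
lemma IsSolution.add (hρ : 0 < ρ) (hp : IsSolution φ ρ t T p)
    (hU : ∀ z ∈ U, |residual φ p.1 p.2 z| ≤ t) : IsSolution φ ρ t (T + U) p := by
  have hmin := (isMinimizer_iff hρ).1 hp.1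
  have hp0 : objective φ ρ t (T + U) p = objective φ ρ t T p := by
    rw [objective_add, sum_excess_eq_zero hU, mul_zero, add_zero]
  have hle (q : H × ℝ) : objective φ ρ t T q ≤ objective φ ρ t (T + U) q := by
    rw [objective_add]
    exact le_add_of_nonneg_right (mul_nonneg hρ.le sum_excess_nonneg)
  refine ⟨(isMinimizer_iff hρ).2 fun q => hp0.trans_le ((hmin q).trans (hle q)), fun q hq => ?_⟩
  -- The two objectives have the same minimum value, so a minimizer for `T + U` is one for `T`.
  refine hp.2 q ((isMinimizer_iff hρ).2 fun r => ?_)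
  have h := (isMinimizer_iff hρ).1 hq p
  exact (hle q).trans ((h.trans_eq hp0).trans (hmin r))

lemma finite_setOf_mem {α : Type*} (S : Multiset α) : {a | a ∈ S}.Finite := by
  classical
  exact (S.toFinset.finite_toSet).subset fun a ha => by simpa using ha

lemma exists_segment_le (hU : ∀ z ∈ U, |residual φ p.1 p.2 z| < t) (q : H × ℝ) :
    ∃ s : ℝ, 0 < s ∧ s < 1 ∧ ∀ z ∈ U,
      |residual φ ((1 - s) • p + s • q).1 ((1 - s) • p + s • q).2 z| ≤ t := by
  have h : ∀ᶠ s : ℝ in 𝓝[>] 0, ∀ z ∈ U,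
      |residual φ ((1 - s) • p + s • q).1 ((1 - s) • p + s • q).2 z| ≤ t := by
    refine (Set.Finite.eventually_all (finite_setOf_mem U)).2 fun z hz => ?_
    have hc : Continuous fun s : ℝ =>
        |residual φ ((1 - s) • p + s • q).1 ((1 - s) • p + s • q).2 z| := by
      simp only [residual_segment]
      fun_prop
    have h0 := hc.tendsto 0
    simp only [sub_zero, one_smul, zero_smul, add_zero] at h0
    exact ((h0.mono_left nhdsWithin_le_nhds).eventually_lt_const (hU z hz)).mono fun _ h => h.le
  obtain ⟨s, hs, h0, h1⟩ := (h.and (Ioo_mem_nhdsGT one_pos)).exists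
  exact ⟨s, h0, h1, hs⟩

/-- Removing examples with residual less than `t` does not change the solution. -/
lemma IsSolution.of_add (hρ : 0 < ρ) (hp : IsSolution φ ρ t (T + U) p)
    (hU : ∀ z ∈ U, |residual φ p.1 p.2 z| < t) : IsSolution φ ρ t T p := by
  have hmin := (isMinimizer_iff hρ).1 hp.1
  have heq {q : H × ℝ} (hq : ∀ z ∈ U, |residual φ q.1 q.2 z| ≤ t) :
      objective φ ρ t (T + U) q = objective φ ρ t T q := by
    rw [objective_add, sum_excess_eq_zero hq, mul_zero, add_zero]
  have hp0 := heq fun z hz => (hU z hz).le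
  have hT : IsMinimizer φ ρ t T p := by
    refine (isMinimizer_iff hρ).2 fun q => ?_
    -- Close to `p` the examples of `U` cost nothing and both objectives agree; convexity turns this
    -- local comparison into a global one.
    obtain ⟨s, hs0, hs1, hs⟩ := exists_segment_le hU q
    have h1 := hmin ((1 - s) • p + s • q)
    rw [heq hs, hp0] at h1
    have h2 := objective_segment (φ := φ) (t := t) (S := T) hρ hs0.le hs1.le p q
    have h3 : 0 ≤ s * (1 - s) * ‖p.1 - q.1‖ ^ 2 := by
      have : 0 ≤ 1 - s := by linarith
      positivity
    have h4 : s * objective φ ρ t T p ≤ s * objective φ ρ t T q := by linarith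
    exact le_of_mul_le_mul_left h4 hs0
  refine ⟨hT, fun q hq => ?_⟩
  -- The same local argument for the tie-break, by convexity of `|b|`.
  obtain ⟨s, hs0, hs1, hs⟩ := exists_segment_le hU q
  have hr := (isMinimizer_iff hρ).1 (hT.segment hρ hq hs0.le hs1.le)
  have h1 : IsMinimizer φ ρ t (T + U) ((1 - s) • p + s • q) :=
    (isMinimizer_iff hρ).2 fun r => by
      rw [heq hs]
      exact (hr p).trans (hp0.symm.trans_le (hmin r))
  have h2 := hp.2 _ h1
  simp only [Prod.snd_add, Prod.smul_snd, smul_eq_mul] at h2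
  have h3 := abs_add_le ((1 - s) * p.2) (s * q.2)
  rw [abs_mul, abs_mul, abs_of_pos (by linarith : 0 < 1 - s), abs_of_pos hs0] at h3
  have h4 : s * |p.2| ≤ s * |q.2| := by linarith
  exact le_of_mul_le_mul_left h4 hs0

/-- The span of the features of the examples in `S`. -/
def featureSpan (φ : X → H) (S : Multiset (X × ℝ)) : Submodule ℝ H :=
  Submodule.span ℝ ((fun z : X × ℝ => φ z.1) '' {z | z ∈ S})

instance finiteDimensional_featureSpan : FiniteDimensional ℝ (featureSpan φ S) :=
  FiniteDimensional.span_of_finite ℝ ((finite_setOf_mem S).image _)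

/-- Representer theorem: projecting keeps the inner products with the features and does not increase
the norm. It confines minimization to a finite-dimensional space, where compactness is available. -/
lemma objective_starProjection_le (p : H × ℝ) :
    objective φ ρ t S ((featureSpan φ S).starProjection p.1, p.2) ≤ objective φ ρ t S p := by
  have h : S.map (excess φ t ((featureSpan φ S).starProjection p.1, p.2)) =
      S.map (excess φ t p) := by
    refine Multiset.map_congr rfl fun z hz => ?_
    have hmem : φ z.1 ∈ featureSpan φ S := Submodule.subset_span ⟨z, hz, rfl⟩
    simp only [excess, residual]
    rw [Submodule.inner_starProjection_left_eq_right,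
      Submodule.starProjection_eq_self_iff.2 hmem]
  unfold objective
  rw [h]
  gcongr
  exact Submodule.norm_starProjection_apply_le _ _

/-- The regularizer bounds `w`; then the excess of a single example bounds `b`. Without any example
`b` would be free. -/
lemma exists_norm_le_of_objective_le (hρ : 0 < ρ) (hS : S ≠ 0) (c : ℝ) :
    ∃ C, ∀ p : H × ℝ, objective φ ρ t S p ≤ c → ‖p‖ ≤ C := by
  obtain ⟨z, hz⟩ := Multiset.exists_mem_of_ne_zero hS
  refine ⟨max (|c| + 1) (|z.2| + (|c| + 1) * ‖φ z.1‖ + (t + c / ρ)), fun p hp => ?_⟩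
  have hsum : 0 ≤ ρ * (S.map (excess φ t p)).sum := mul_nonneg hρ.le sum_excess_nonneg
  unfold objective at hp
  have hw : ‖p.1‖ ≤ |c| + 1 := by
    by_contra! h
    nlinarith [le_abs_self c, abs_nonneg c]
  have hez : excess φ t p z ≤ (S.map (excess φ t p)).sum := by
    refine Multiset.single_le_sum (fun x hx => ?_) _ (Multiset.mem_map_of_mem _ hz)
    obtain ⟨z, -, rfl⟩ := Multiset.mem_map.1 hx
    exact excess_nonneg z
  have he : excess φ t p z ≤ c / ρ := by
    rw [le_div_iff₀ hρ]
    nlinarith [sq_nonneg ‖p.1‖]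
  have hr : |residual φ p.1 p.2 z| ≤ t + c / ρ := by
    have := (le_max_right 0 (|residual φ p.1 p.2 z| - t)).trans he
    linarith
  refine norm_prod_le_iff.2 ⟨hw.trans (le_max_left _ _), le_trans ?_ (le_max_right _ _)⟩
  have hb : p.2 = z.2 - inner ℝ p.1 (φ z.1) - residual φ p.1 p.2 z := by
    unfold residual
    ring
  have hi : |inner ℝ p.1 (φ z.1)| ≤ (|c| + 1) * ‖φ z.1‖ :=
    (abs_real_inner_le_norm _ _).trans (by gcongr)
  rw [hb, Real.norm_eq_abs]
  have h1 := abs_sub (z.2 - inner ℝ p.1 (φ z.1)) (residual φ p.1 p.2 z)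
  have h2 := abs_sub z.2 (inner ℝ p.1 (φ z.1))
  linarith

lemma exists_isMinimizer (hρ : 0 < ρ) (φ : X → H) (t : ℝ) (S : Multiset (X × ℝ)) :
    ∃ p, IsMinimizer φ ρ t S p ∧ p.1 ∈ featureSpan φ S := by
  by_cases hS : S = 0
  · refine ⟨(0, 0), (isMinimizer_iff hρ).2 fun q => ?_, zero_mem _⟩
    simp [objective, hS]
  · let e : featureSpan φ S × ℝ → H × ℝ := fun v => (v.1, v.2)
    have he : Continuous e := by fun_prop
    obtain ⟨C, hC⟩ := exists_norm_le_of_objective_le (φ := φ) (t := t) hρ hS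
      (objective φ ρ t S (e 0))
    have hK : IsCompact {v | objective φ ρ t S (e v) ≤ objective φ ρ t S (e 0)} := by
      refine Metric.isCompact_of_isClosed_isBounded
        (isClosed_le (continuous_objective.comp he) continuous_const)
        (isBounded_iff_forall_norm_le.2 ⟨C, fun v hv => ?_⟩)
      exact hC _ hv
    obtain ⟨v, hv, hmin⟩ := hK.exists_isMinOn ⟨0, le_refl (objective φ ρ t S (e 0))⟩
      (continuous_objective.comp he).continuousOn
    refine ⟨e v, (isMinimizer_iff hρ).2 fun q => ?_, v.1.2⟩
    refine le_trans ?_ (objective_starProjection_le q)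
    let u : featureSpan φ S × ℝ := (⟨_, Submodule.starProjection_apply_mem _ q.1⟩, q.2)
    change objective φ ρ t S (e v) ≤ objective φ ρ t S (e u)
    by_cases hu : objective φ ρ t S (e u) ≤ objective φ ρ t S (e 0)
    · exact hmin hu
    · exact le_trans hv (not_le.1 hu).le

lemma exists_isSolution (hρ : 0 < ρ) (φ : X → H) (t : ℝ) (S : Multiset (X × ℝ)) :
    ∃ p, IsSolution φ ρ t S p ∧ p.1 ∈ featureSpan φ S := by
  obtain ⟨p, hp, hmem⟩ := exists_isMinimizer hρ φ t S
  have hp' := (isMinimizer_iff hρ).1 hp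
  have hK : IsCompact ({b | objective φ ρ t S (p.1, b) ≤ objective φ ρ t S p} ∩
      Set.Icc (-|p.2|) |p.2|) :=
    isCompact_Icc.inter_left
      (isClosed_le (continuous_objective.comp (by fun_prop)) continuous_const)
  obtain ⟨b, ⟨hb, hb'⟩, hmin⟩ := hK.exists_isMinOn
    ⟨p.2, le_refl (objective φ ρ t S p), abs_le.1 le_rfl⟩ continuous_abs.continuousOn
  refine ⟨(p.1, b), ⟨(isMinimizer_iff hρ).2 fun q => le_trans hb (hp' q), fun q hq => ?_⟩, hmem⟩
  by_cases h : |q.2| ≤ |p.2|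
  · refine hmin ⟨?_, abs_le.1 h⟩
    have := (isMinimizer_iff hρ).1 hq p
    rwa [← Prod.mk.eta (p := q), ← hp.fst_eq hρ hq] at this
  · exact (abs_le.2 hb').trans (not_le.1 h).le

lemma isSolution_solution (hρ : 0 < ρ) (φ : X → H) (t : ℝ) (S : Multiset (X × ℝ)) :
    IsSolution φ ρ t S (solution φ ρ t S) :=
  Classical.epsilon_spec ((exists_isSolution hρ φ t S).imp fun _ h => h.1)

lemma IsSolution.solution_eq (hρ : 0 < ρ) (hp : IsSolution φ ρ t S p) :
    solution φ ρ t S = p :=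
  (isSolution_solution hρ φ t S).unique hρ hp

lemma solution_fst_mem (hρ : 0 < ρ) (φ : X → H) (t : ℝ) (S : Multiset (X × ℝ)) :
    (solution φ ρ t S).1 ∈ featureSpan φ S := by
  obtain ⟨p, hp, hmem⟩ := exists_isSolution hρ φ t S
  rwa [hp.solution_eq hρ]

end Optimization

end SVR

namespace SVR

/-! ### Measurability of the solution through the kernel -/

section Measurability

open Filter Topology

variable {X H : Type*} [NormedAddCommGroup H] [InnerProductSpace ℝ H] {φ : X → H} {ρ t : ℝ}

/-- Near-minimizers of the objective with a vanishing quadratic penalty on `b` converge to the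
solution. -/
lemma tendsto_solution (hρ : 0 < ρ) {S : Multiset (X × ℝ)} {p : ℕ → H × ℝ}
    (h : ∀ n : ℕ, objective φ ρ t S (p n) + (p n).2 ^ 2 / (n + 1) ≤
      objective φ ρ t S (solution φ ρ t S) + (solution φ ρ t S).2 ^ 2 / (n + 1) +
        1 / (n + 1) ^ 2) :
    Tendsto p atTop (𝓝 (solution φ ρ t S)) := by
  set s := solution φ ρ t S with hs
  have hsol : IsSolution φ ρ t S s := isSolution_solution hρ φ t S
  have hmin := (isMinimizer_iff hρ).1 hsol.1
  have hinv : Tendsto (fun n : ℕ => 1 / ((n : ℝ) + 1)) atTop (𝓝 0) :=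
    tendsto_one_div_add_atTop_nhds_zero_nat
  have hobj (n : ℕ) : objective φ ρ t S (p n) ≤
      objective φ ρ t S s + (s.2 ^ 2 * (1 / (n + 1)) + (1 / (n + 1)) ^ 2) := by
    have h1 : 0 ≤ (p n).2 ^ 2 / ((n : ℝ) + 1) := by positivity
    have h2 := h n
    have h3 : s.2 ^ 2 / ((n : ℝ) + 1) = s.2 ^ 2 * (1 / (n + 1)) := by ring
    have h4 : 1 / ((n : ℝ) + 1) ^ 2 = (1 / (n + 1)) ^ 2 := (one_div_pow _ _).symm
    linarith
  have herr : Tendsto (fun n : ℕ => s.2 ^ 2 * (1 / ((n : ℝ) + 1)) + (1 / ((n : ℝ) + 1)) ^ 2)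
      atTop (𝓝 0) := by
    simpa using (hinv.const_mul (s.2 ^ 2)).add (hinv.pow 2)
  -- The penalty has size `1/(n+1)`, so multiplying through by `n+1` leaves a vanishing error only
  -- because the tolerance is of the smaller order `1/(n+1)^2`.
  have hsq (n : ℕ) : (p n).2 ^ 2 ≤ s.2 ^ 2 + 1 / (n + 1) := by
    have hn : (0 : ℝ) < n + 1 := by positivity
    have h1 : (p n).2 ^ 2 / ((n : ℝ) + 1) ≤ (s.2 ^ 2 + 1 / (n + 1)) / (n + 1) := by
      have h2 := h n
      have h3 := hmin (p n)
      have h4 : (s.2 ^ 2 + 1 / ((n : ℝ) + 1)) / (n + 1) =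
          s.2 ^ 2 / (n + 1) + 1 / (n + 1) ^ 2 := by
        field_simp
      linarith
    exact (div_le_div_iff_of_pos_right hn).1 h1
  have hw : Tendsto (fun n => (p n).1) atTop (𝓝 s.1) := by
    rw [tendsto_iff_norm_sub_tendsto_zero]
    have h1 : Tendsto (fun n => ‖(p n).1 - s.1‖ ^ 2) atTop (𝓝 0) := by
      have herr2 := herr.const_mul 2
      rw [mul_zero] at herr2
      refine squeeze_zero (fun n => sq_nonneg _) (fun n => ?_) herr2
      rw [norm_sub_rev]
      refine (norm_sub_sq_le hρ hmin (p n)).trans ?_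
      have := hobj n
      linarith
    simpa using h1.sqrt
  -- The offsets stay in a compact interval, and each cluster point gives a solution, hence is the
  -- offset of the unique one.
  have hb : Tendsto (fun n => (p n).2) atTop (𝓝 s.2) := by
    refine (isCompact_Icc (a := -(|s.2| + 1)) (b := |s.2| + 1)).tendsto_nhds_of_unique_mapClusterPt
      (Eventually.of_forall fun n => ?_) fun b _ hb => ?_
    · refine abs_le.1 (abs_le_of_sq_le_sq ?_ (by positivity))
      have h1 := hsq n
      have h2 : 1 / ((n : ℝ) + 1) ≤ 1 := by
        rw [div_le_one (by positivity)]
        linarith [(Nat.cast_nonneg n : (0 : ℝ) ≤ n)]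
      nlinarith [abs_nonneg s.2, sq_abs s.2]
    · obtain ⟨ψ, hψ, hlim⟩ := hb.tendsto_subseq
      have hlim' : Tendsto (fun n => p (ψ n)) atTop (𝓝 (s.1, b)) :=
        (hw.comp hψ.tendsto_atTop).prodMk_nhds hlim
      have h1 : objective φ ρ t S (s.1, b) ≤ objective φ ρ t S s := by
        refine le_of_tendsto_of_tendsto' ((continuous_objective.tendsto _).comp hlim') ?_
          fun n => hobj (ψ n)
        simpa using (herr.comp hψ.tendsto_atTop).const_add (objective φ ρ t S s)
      have h2 : b ^ 2 ≤ s.2 ^ 2 := by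
        refine le_of_tendsto_of_tendsto' (hlim.pow 2) ?_ fun n => hsq (ψ n)
        simpa using (hinv.comp hψ.tendsto_atTop).const_add (s.2 ^ 2)
      have h3 : IsSolution φ ρ t S (s.1, b) :=
        ⟨(isMinimizer_iff hρ).2 fun q => h1.trans (hmin q),
          fun q hq => (sq_le_sq.1 h2).trans (hsol.2 q hq)⟩
      exact congrArg Prod.snd (h3.unique hρ hsol)
  exact hw.prodMk_nhds hb

variable {ι : Type*}

/-- The multiset of the examples with index in `J`. -/
def subsample {α : Type*} (x : ι → α) (J : Finset ι) : Multiset α := J.val.map x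

/-- The linear combination of the features of the examples with index in `J`. -/
noncomputable def featureComb (φ : X → H) (x : ι → X × ℝ) (J : Finset ι) (a : ι → ℝ) : H :=
  ∑ i ∈ J, a i • φ (x i).1

lemma objective_subsample (x : ι → X × ℝ) (J : Finset ι) (p : H × ℝ) :
    objective φ ρ t (subsample x J) p = ‖p.1‖ ^ 2 + ρ * ∑ j ∈ J, excess φ t p (x j) := by
  rw [objective, subsample, Multiset.map_map]
  rfl

lemma exists_featureComb_eq {x : ι → X × ℝ} {J : Finset ι} {w : H}
    (hw : w ∈ featureSpan φ (subsample x J)) : ∃ a : ι → ℝ, featureComb φ x J a = w := by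
  classical
  have h : (fun z : X × ℝ => φ z.1) '' {z | z ∈ subsample x J} =
      (fun i => φ (x i).1) '' (J : Set ι) := by
    ext v
    simp [subsample]
  rw [featureSpan, h] at hw
  exact (Submodule.mem_span_image_finset_iff_exists_fun' ℝ).1 hw

variable [MeasurableSpace X]

lemma measurable_inner_featureComb
    (hφ : Measurable fun p : X × X => (inner ℝ (φ p.1) (φ p.2) : ℝ)) (I J : Finset ι)
    {α : Type*} [MeasurableSpace α] {f g : α → ι → X × ℝ} (hf : Measurable f) (hg : Measurable g)
    {a b : α → ι → ℝ} (ha : Measurable a) (hb : Measurable b) :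
    Measurable fun y => (inner ℝ (featureComb φ (f y) I (a y)) (featureComb φ (g y) J (b y)) : ℝ) := by
  simp only [featureComb, sum_inner, inner_sum, real_inner_smul_left, real_inner_smul_right]
  refine Finset.measurable_sum _ fun i _ => Finset.measurable_sum _ fun j _ => ?_
  refine (measurable_pi_iff.1 hb _).mul ((measurable_pi_iff.1 ha _).mul ?_)
  exact hφ.comp ((measurable_pi_iff.1 hf _).fst.prodMk (measurable_pi_iff.1 hg _).fst)

lemma measurable_inner_featureComb_feature
    (hφ : Measurable fun p : X × X => (inner ℝ (φ p.1) (φ p.2) : ℝ)) (I : Finset ι)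
    {α : Type*} [MeasurableSpace α] {f : α → ι → X × ℝ} (hf : Measurable f)
    {a : α → ι → ℝ} (ha : Measurable a) {g : α → X} (hg : Measurable g) :
    Measurable fun y => (inner ℝ (featureComb φ (f y) I (a y)) (φ (g y)) : ℝ) := by
  simp only [featureComb, sum_inner, real_inner_smul_left]
  refine Finset.measurable_sum _ fun i _ => (measurable_pi_iff.1 ha _).mul ?_
  exact hφ.comp ((measurable_pi_iff.1 hf _).fst.prodMk hg)

lemma measurable_objective_featureComb
    (hφ : Measurable fun p : X × X => (inner ℝ (φ p.1) (φ p.2) : ℝ)) (J : Finset ι) (a : ι → ℝ)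
    (b : ℝ) : Measurable fun x : ι → X × ℝ =>
      objective φ ρ t (subsample x J) (featureComb φ x J a, b) := by
  simp only [objective_subsample, ← real_inner_self_eq_norm_sq]
  refine (measurable_inner_featureComb hφ J J measurable_id measurable_id measurable_const
    measurable_const).add (measurable_const.mul (Finset.measurable_sum _ fun j _ => ?_))
  have h := measurable_inner_featureComb_feature hφ J (f := fun x : ι → X × ℝ => x) measurable_id
    (a := fun _ => a) measurable_const (g := fun x => (x j).1) (measurable_pi_apply j).fst
  have h2 : Measurable fun x : ι → X × ℝ => (x j).2 := (measurable_pi_apply j).snd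
  unfold excess residual
  exact measurable_const.max ((((h2.sub h).sub measurable_const).abs).sub measurable_const)

/-- The solution is a pointwise limit of linear combinations of features with measurable
coefficients. -/
lemma exists_measurable_tendsto_solution [Finite ι] (hρ : 0 < ρ)
    (hφ : Measurable fun p : X × X => (inner ℝ (φ p.1) (φ p.2) : ℝ)) (J : Finset ι) :
    ∃ (a : ℕ → (ι → X × ℝ) → ι → ℝ) (b : ℕ → (ι → X × ℝ) → ℝ),
      (∀ n, Measurable (a n)) ∧ (∀ n, Measurable (b n)) ∧
      ∀ x, Tendsto (fun n => (featureComb φ x J (a n x), b n x)) atTop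
        (𝓝 (solution φ ρ t (subsample x J))) := by
  classical
  -- Measurable selection: take the first rational coefficient vector that minimizes the penalized
  -- objective up to `1/(n+1)^2`; density makes it nearly optimal among real ones.
  obtain ⟨d, hd⟩ := exists_surjective_nat ((ι → ℚ) × ℚ)
  let c : (ι → ℚ) × ℚ → (ι → ℝ) × ℝ := Prod.map (Pi.map fun _ => (↑)) (↑)
  have hc : DenseRange c :=
    (DenseRange.piMap fun _ => Rat.denseRange_cast).prodMap Rat.denseRange_cast
  let G : ℕ → (ι → X × ℝ) → (ι → ℝ) × ℝ → ℝ := fun n x v =>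
    objective φ ρ t (subsample x J) (featureComb φ x J v.1, v.2) + v.2 ^ 2 / (n + 1)
  have hG0 (n x v) : 0 ≤ G n x v := by
    have h1 : 0 ≤ objective φ ρ t (subsample x J) (featureComb φ x J v.1, v.2) :=
      add_nonneg (sq_nonneg _) (mul_nonneg hρ.le sum_excess_nonneg)
    positivity
  have hGm (n v) : Measurable fun x => G n x v :=
    (measurable_objective_featureComb hφ J v.1 v.2).add measurable_const
  have hGc (n x) : Continuous (G n x) := by
    refine (continuous_objective.comp (Continuous.prodMk ?_ continuous_snd)).add (by fun_prop)
    unfold featureComb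
    fun_prop
  have hex (n : ℕ) (x) : ∃ k, ∀ k', G n x (c (d k)) ≤ G n x (c (d k')) + 1 / (n + 1) ^ 2 := by
    have hlt : ⨅ k, G n x (c (d k)) < (⨅ k, G n x (c (d k))) + 1 / ((n : ℝ) + 1) ^ 2 :=
      lt_add_of_pos_right _ (by positivity)
    obtain ⟨k, hk⟩ := exists_lt_of_ciInf_lt hlt
    refine ⟨k, fun k' => hk.le.trans ?_⟩
    gcongr
    exact ciInf_le ⟨0, by rintro _ ⟨k, rfl⟩; exact hG0 _ _ _⟩ k'
  let K : ℕ → (ι → X × ℝ) → ℕ := fun n x => Nat.find (hex n x)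
  have hK (n) : Measurable (K n) := measurable_find (hex n) fun k => by
    simp only [Set.ofPred_forall]
    exact MeasurableSet.iInter fun k' =>
      measurableSet_le (hGm _ _) ((hGm _ _).add measurable_const)
  refine ⟨fun n x => (c (d (K n x))).1, fun n x => (c (d (K n x))).2, fun n => ?_, fun n => ?_,
    fun x => tendsto_solution hρ fun n => ?_⟩
  · exact (Measurable.of_discrete (f := fun k => (c (d k)).1)).comp (hK n)
  · exact (Measurable.of_discrete (f := fun k => (c (d k)).2)).comp (hK n)
  · obtain ⟨v, hv⟩ := exists_featureComb_eq (solution_fst_mem hρ φ t (subsample x J))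
    have hspec := Nat.find_spec (hex n x)
    have key : ∀ u, G n x (c (d (K n x))) ≤ G n x u + 1 / (n + 1) ^ 2 := by
      refine fun u => hc.induction_on u
        (isClosed_le continuous_const ((hGc n x).add continuous_const)) fun r => ?_
      obtain ⟨k', rfl⟩ := hd r
      exact hspec k'
    have h := key (v, (solution φ ρ t (subsample x J)).2)
    simpa only [G, hv] using h

variable [Finite ι]

/-- The residual at the solution is jointly measurable in the sample and the example. -/
lemma measurable_solResidual (hρ : 0 < ρ)
    (hφ : Measurable fun p : X × X => (inner ℝ (φ p.1) (φ p.2) : ℝ)) (J : Finset ι) :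
    Measurable fun y : (ι → X × ℝ) × (X × ℝ) => solResidual φ ρ t (subsample y.1 J) y.2 := by
  obtain ⟨a, b, ha, hb, hlim⟩ := exists_measurable_tendsto_solution (t := t) hρ hφ J
  refine measurable_of_tendsto_metrizable (f := fun n y =>
    residual φ (featureComb φ y.1 J (a n y.1)) (b n y.1) y.2) (fun n => ?_) ?_
  · exact (measurable_snd.snd.sub (measurable_inner_featureComb_feature hφ J measurable_fst
      ((ha n).comp measurable_fst) measurable_snd.fst)).sub ((hb n).comp measurable_fst)
  · refine tendsto_pi_nhds.2 fun y => ?_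
    have hc : Continuous fun p : H × ℝ => residual φ p.1 p.2 y.2 := by
      unfold residual
      fun_prop
    exact (hc.tendsto _).comp (hlim y.1)

/-- `H` carries no σ-algebra, so equality of the `w` parts is tested by their squared distance,
which is a limit of expressions in the kernel. -/
lemma measurableSet_solution_eq (hρ : 0 < ρ)
    (hφ : Measurable fun p : X × X => (inner ℝ (φ p.1) (φ p.2) : ℝ)) (I J : Finset ι) :
    MeasurableSet {x : ι → X × ℝ |
      solution φ ρ t (subsample x I) = solution φ ρ t (subsample x J)} := by
  obtain ⟨a, b, ha, hb, hlim⟩ := exists_measurable_tendsto_solution (t := t) hρ hφ I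
  obtain ⟨a', b', ha', hb', hlim'⟩ := exists_measurable_tendsto_solution (t := t) hρ hφ J
  have hw : Measurable fun x : ι → X × ℝ => ‖(solution φ ρ t (subsample x I)).1 -
      (solution φ ρ t (subsample x J)).1‖ ^ 2 := by
    refine measurable_of_tendsto_metrizable (f := fun n x =>
      ‖featureComb φ x I (a n x) - featureComb φ x J (a' n x)‖ ^ 2) (fun n => ?_) ?_
    · simp only [norm_sub_sq_real]
      simp only [← real_inner_self_eq_norm_sq]
      have h1 := measurable_inner_featureComb hφ I I measurable_id measurable_id (ha n) (ha n)
      have h2 := measurable_inner_featureComb hφ I J measurable_id measurable_id (ha n) (ha' n)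
      have h3 := measurable_inner_featureComb hφ J J measurable_id measurable_id (ha' n) (ha' n)
      exact (h1.sub (measurable_const.mul h2)).add h3
    · exact tendsto_pi_nhds.2 fun x =>
        (((hlim x).fst_nhds.sub (hlim' x).fst_nhds).norm).pow 2
  have hβ (K : Finset ι) : Measurable fun x : ι → X × ℝ => (solution φ ρ t (subsample x K)).2 := by
    obtain ⟨a, b, -, hb, hlim⟩ := exists_measurable_tendsto_solution (t := t) hρ hφ K
    exact measurable_of_tendsto_metrizable hb (tendsto_pi_nhds.2 fun x => (hlim x).snd_nhds)
  have h : {x : ι → X × ℝ | solution φ ρ t (subsample x I) = solution φ ρ t (subsample x J)} =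
      {x | ‖(solution φ ρ t (subsample x I)).1 - (solution φ ρ t (subsample x J)).1‖ ^ 2 = 0} ∩
        {x | (solution φ ρ t (subsample x I)).2 = (solution φ ρ t (subsample x J)).2} := by
    ext x
    simp [Prod.ext_iff, sub_eq_zero]
  rw [h]
  exact (measurableSet_eq_fun hw measurable_const).inter (measurableSet_eq_fun (hβ I) (hβ J))

end Measurability

end SVR

namespace SVR

/-! ### Compressions as index sets, and their stability -/

section Compressor

variable {X H : Type*} [NormedAddCommGroup H] [InnerProductSpace ℝ H] {φ : X → H} {ρ t : ℝ}

section

variable {ι α : Type*}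

/-- Index sets distinguish repeated examples, which lets sub-multisets be handled as subsets of
positions. -/
lemma exists_subset_subsample_eq {x : ι → α} {J : Finset ι} {T : Multiset α}
    (h : T ≤ subsample x J) : ∃ I ⊆ J, subsample x I = T := by
  obtain ⟨l, hl⟩ := Quot.exists_rep J.val
  have hl : (l : Multiset ι) = J.val := hl
  rw [subsample, ← hl, Multiset.map_coe] at h
  induction T using Quotient.inductionOn with | h T => ?_
  obtain ⟨T', hT', hsub⟩ := Multiset.coe_le.1 h
  obtain ⟨l', hl', rfl⟩ := List.sublist_map_iff.1 hsub
  have hle : (l' : Multiset ι) ≤ J.val := hl ▸ Multiset.coe_le.2 hl'.subperm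
  refine ⟨⟨l', Multiset.nodup_of_le hle J.nodup⟩, Finset.val_le_iff.1 hle, ?_⟩
  exact Multiset.coe_eq_coe.2 hT'

lemma subsample_mono {x : ι → α} {I J : Finset ι} (h : I ⊆ J) :
    subsample x I ≤ subsample x J := Multiset.map_le_map (Finset.val_le_iff.2 h)

lemma card_subsample (x : ι → α) (J : Finset ι) : (subsample x J).card = J.card :=
  Multiset.card_map _ _

lemma mem_subsample {x : ι → α} {J : Finset ι} {z : α} :
    z ∈ subsample x J ↔ ∃ i ∈ J, x i = z := Multiset.mem_map

lemma subsample_congr {x y : ι → α} {J : Finset ι} (h : ∀ i ∈ J, x i = y i) :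
    subsample x J = subsample y J := Multiset.map_congr rfl h

lemma filter_subsample (x : ι → α) (J : Finset ι) (p : α → Prop) [DecidablePred p] :
    (subsample x J).filter p = subsample x (J.filter fun i => p (x i)) := by
  rw [subsample, Multiset.filter_map]
  rfl

lemma subsample_union [DecidableEq ι] (x : ι → α) {I J : Finset ι} (h : Disjoint I J) :
    subsample x (I ∪ J) = subsample x I + subsample x J := by
  rw [← Finset.disjUnion_eq_union _ _ h]
  exact Multiset.map_add x I.val J.val

lemma subsample_eq_add_sdiff [DecidableEq ι] (x : ι → α) {I J : Finset ι} (h : I ⊆ J) :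
    subsample x J = subsample x I + subsample x (J \ I) := by
  rw [← subsample_union x Finset.disjoint_sdiff, Finset.union_sdiff_of_subset h]

end

/-! ### Candidates and their cardinality -/

lemma isCandidate_filter (hρ : 0 < ρ) (φ : X → H) (t : ℝ) (S : Multiset (X × ℝ)) :
    ∃ T, IsCandidate φ ρ t S T := by
  classical
  set r : X × ℝ → ℝ := fun z => |solResidual φ ρ t S z| with hr
  have hsplit : plusPart φ ρ t S + S.filter (fun z => r z = t) + S.filter (fun z => r z < t) =
      S := by
    have h1 : plusPart φ ρ t S + S.filter (fun z => r z = t) = S.filter (fun z => ¬ r z < t) := by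
      rw [plusPart, Multiset.filter_add_filter]
      have h2 : S.filter (fun z => t < r z ∧ r z = t) = 0 :=
        Multiset.filter_eq_nil.2 fun z _ h => h.1.ne' h.2
      have h3 : S.filter (fun z => t < r z ∨ r z = t) = S.filter (fun z => ¬ r z < t) :=
        Multiset.filter_congr fun z _ => by
          rw [not_lt, le_iff_lt_or_eq, eq_comm (a := t)]
      convert (congrArg₂ (· + ·) h3 h2).trans (add_zero _) using 2
    rw [h1, add_comm, Multiset.filter_add_not]
  refine ⟨S.filter fun z => r z = t, Multiset.filter_le _ _,
    fun z hz => (Multiset.mem_filter.1 hz).2, ?_⟩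
  have hsol := isSolution_solution hρ φ t S
  rw [← hsplit] at hsol
  refine (IsSolution.of_add hρ hsol fun z hz => ?_).solution_eq hρ |>.trans (by rw [hsplit])
  rw [hsplit]
  exact (Multiset.mem_filter.1 hz).2

lemma isZeroPart_zeroPart [LinearOrder X] (hρ : 0 < ρ) (φ : X → H) (t : ℝ)
    (S : Multiset (X × ℝ)) : IsZeroPart φ ρ t S (zeroPart φ ρ t S) := by
  classical
  refine Classical.epsilon_spec (p := IsZeroPart φ ρ t S) ?_
  obtain ⟨T₀, hT₀⟩ := isCandidate_filter hρ φ t S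
  obtain ⟨T, hT, hmin⟩ := Finset.exists_min_image
    (S.powerset.toFinset.filter fun T => IsCandidate φ ρ t S T)
    (fun T => toLex (T.card, orderKey T))
    ⟨T₀, by simpa using ⟨hT₀.1, hT₀⟩⟩
  refine ⟨T, (Finset.mem_filter.1 hT).2, fun T' hT' => ?_⟩
  exact Prod.Lex.toLex_le_toLex.1 (hmin T' (by simpa using ⟨hT'.1, hT'⟩))

variable {ι : Type*}

/-- `I ⊆ J` indexes the examples with residual exceeding `t` at the solution for the examples in
`J`, together with some examples of residual exactly `t`, and yields the same solution as `J`. -/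
def IsCompressor (φ : X → H) (ρ t : ℝ) (x : ι → X × ℝ) (J I : Finset ι) : Prop :=
  I ⊆ J ∧ solution φ ρ t (subsample x I) = solution φ ρ t (subsample x J) ∧
    ∀ i ∈ J, (t < |solResidual φ ρ t (subsample x J) (x i)| → i ∈ I) ∧
      (i ∈ I → t ≤ |solResidual φ ρ t (subsample x J) (x i)|)

/-- A compressor of smallest cardinality. -/
def IsOptimal (φ : X → H) (ρ t : ℝ) (x : ι → X × ℝ) (J I : Finset ι) : Prop :=
  IsCompressor φ ρ t x J I ∧ ∀ I', IsCompressor φ ρ t x J I' → I.card ≤ I'.card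

variable {x y : ι → X × ℝ} {I J J' : Finset ι}

lemma exists_isCompressor_of_isCandidate {T : Multiset (X × ℝ)}
    (hT : IsCandidate φ ρ t (subsample x J) T) :
    ∃ I, IsCompressor φ ρ t x J I ∧ subsample x I = plusPart φ ρ t (subsample x J) + T := by
  classical
  obtain ⟨hle, hres, hsol⟩ := hT
  set S := subsample x J with hS
  have hT' : T ≤ S.filter fun z => |solResidual φ ρ t S z| = t :=
    Multiset.le_filter.2 ⟨hle, hres⟩
  rw [hS, filter_subsample] at hT'
  obtain ⟨I₀, hI₀, rfl⟩ := exists_subset_subsample_eq hT'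
  set K := J.filter fun i => t < |solResidual φ ρ t S (x i)| with hK
  have hplus : plusPart φ ρ t S = subsample x K := by
    rw [plusPart, hS, filter_subsample]
  have hdisj : Disjoint K I₀ := by
    refine Finset.disjoint_left.2 fun i hi hi' => ?_
    exact (Finset.mem_filter.1 hi).2.ne' (Finset.mem_filter.1 (hI₀ hi')).2
  have hsub : subsample x (K ∪ I₀) = plusPart φ ρ t S + subsample x I₀ := by
    rw [subsample_union x hdisj, hplus]
  refine ⟨K ∪ I₀, ⟨Finset.union_subset (Finset.filter_subset _ _)
    (hI₀.trans (Finset.filter_subset _ _)), by rw [hsub, hsol], fun i hi => ⟨fun h => ?_,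
    fun h => ?_⟩⟩, hsub⟩
  · exact Finset.mem_union_left _ (Finset.mem_filter.2 ⟨hi, h⟩)
  · rcases Finset.mem_union.1 h with h | h
    · exact (Finset.mem_filter.1 h).2.le
    · exact (Finset.mem_filter.1 (hI₀ h)).2.ge

lemma IsCompressor.exists_isCandidate (hI : IsCompressor φ ρ t x J I) :
    ∃ T, IsCandidate φ ρ t (subsample x J) T ∧
      subsample x I = plusPart φ ρ t (subsample x J) + T := by
  classical
  obtain ⟨hsub, hsol, hres⟩ := hI
  set S := subsample x J with hS
  set K := J.filter fun i => t < |solResidual φ ρ t S (x i)| with hK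
  have hKI : K ⊆ I := fun i hi => (hres i (Finset.mem_filter.1 hi).1).1 (Finset.mem_filter.1 hi).2
  have hplus : plusPart φ ρ t S = subsample x K := by
    rw [plusPart, hS, filter_subsample]
  have heq : subsample x I = plusPart φ ρ t S + subsample x (I \ K) := by
    rw [hplus, ← subsample_eq_add_sdiff x hKI]
  refine ⟨subsample x (I \ K), ⟨subsample_mono (Finset.sdiff_subset.trans hsub), fun z hz => ?_,
    by rw [← heq, hsol]⟩, heq⟩
  obtain ⟨i, hi, rfl⟩ := mem_subsample.1 hz
  obtain ⟨hi, hiK⟩ := Finset.mem_sdiff.1 hi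
  refine le_antisymm (not_lt.1 fun h => hiK (Finset.mem_filter.2 ⟨hsub hi, h⟩))
    ((hres i (hsub hi)).2 hi)

lemma exists_isOptimal (hρ : 0 < ρ) (φ : X → H) (t : ℝ) (x : ι → X × ℝ) (J : Finset ι) :
    ∃ I, IsOptimal φ ρ t x J I := by
  classical
  obtain ⟨T, hT⟩ := isCandidate_filter hρ φ t (subsample x J)
  obtain ⟨I₀, hI₀, -⟩ := exists_isCompressor_of_isCandidate hT
  obtain ⟨I, hI, hmin⟩ := Finset.exists_min_image
    (J.powerset.filter fun I => IsCompressor φ ρ t x J I) Finset.card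
    ⟨I₀, by simpa using ⟨hI₀.1, hI₀⟩⟩
  exact ⟨I, (Finset.mem_filter.1 hI).2, fun I' hI' => hmin I' (by simpa using ⟨hI'.1, hI'⟩)⟩

/-- The bound sees the compression only through its size, so the ordering that selects `S₀` among
candidates of equal size plays no further role. -/
lemma IsOptimal.card_compression [LinearOrder X] (hρ : 0 < ρ) (hI : IsOptimal φ ρ t x J I) :
    (compression φ ρ t (subsample x J)).card = I.card := by
  have hz := isZeroPart_zeroPart hρ φ t (subsample x J)
  rw [compression, Multiset.card_add]
  apply le_antisymm
  · obtain ⟨T, hT, heq⟩ := hI.1.exists_isCandidate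
    have h := congrArg Multiset.card heq
    rw [card_subsample, Multiset.card_add] at h
    rcases hz.2 T hT with h' | h' <;> omega
  · obtain ⟨I', hI', heq⟩ := exists_isCompressor_of_isCandidate hz.1
    have h := congrArg Multiset.card heq
    rw [card_subsample, Multiset.card_add] at h
    exact h ▸ hI.2 I' hI'

/-! ### Passing to a smaller sample -/

lemma IsCompressor.abs_solResidual_le (h : IsCompressor φ ρ t x J I) {j : ι} (hj : j ∈ J)
    (hjI : j ∉ I) : |solResidual φ ρ t (subsample x I) (x j)| ≤ t := by
  rw [solResidual, h.2.1]
  exact not_lt.1 fun h' => hjI ((h.2.2 j hj).1 h')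

lemma IsCompressor.solution_eq_of_subset (hρ : 0 < ρ) (h : IsCompressor φ ρ t x J' I)
    (hIJ : I ⊆ J) (hJ : J ⊆ J') :
    solution φ ρ t (subsample x J) = solution φ ρ t (subsample x J') := by
  classical
  rw [← h.2.1, subsample_eq_add_sdiff x hIJ]
  refine ((isSolution_solution hρ φ t (subsample x I)).add hρ fun z hz => ?_).solution_eq hρ
  obtain ⟨j, hj, rfl⟩ := mem_subsample.1 hz
  obtain ⟨hj, hjI⟩ := Finset.mem_sdiff.1 hj
  exact h.abs_solResidual_le (hJ hj) hjI

/-- If a sample has a compressor within a smaller sample, then the compressors of the smaller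
sample are those of the larger one that it contains. -/
lemma IsCompressor.isCompressor_iff (hρ : 0 < ρ) (h : IsCompressor φ ρ t x J' I)
    (hIJ : I ⊆ J) (hJ : J ⊆ J') (K : Finset ι) :
    IsCompressor φ ρ t x J K ↔ K ⊆ J ∧ IsCompressor φ ρ t x J' K := by
  have hsol := h.solution_eq_of_subset hρ hIJ hJ
  have hres (z : X × ℝ) : solResidual φ ρ t (subsample x J) z =
      solResidual φ ρ t (subsample x J') z := by rw [solResidual, hsol, solResidual]
  constructor
  · rintro ⟨hK, hs, hr⟩
    refine ⟨hK, hK.trans hJ, hs.trans hsol, fun i hi => ⟨fun hi' => ?_, fun hi' => ?_⟩⟩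
    -- An example of `J'` with residual above `t` lies in `I`, hence in `J`.
    · exact (hr i (hIJ ((h.2.2 i hi).1 hi'))).1 (by rwa [hres])
    · rw [← hres]
      exact (hr i (hK hi')).2 hi'
  · rintro ⟨hK, -, hs, hr⟩
    refine ⟨hK, hs.trans hsol.symm, fun i hi => ?_⟩
    rw [hres]
    exact hr i (hJ hi)

lemma IsOptimal.of_subset (hρ : 0 < ρ) (h : IsOptimal φ ρ t x J' I) (hIJ : I ⊆ J)
    (hJ : J ⊆ J') : IsOptimal φ ρ t x J I :=
  ⟨(h.1.isCompressor_iff hρ hIJ hJ I).2 ⟨hIJ, h.1⟩,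
    fun K hK => h.2 K ((h.1.isCompressor_iff hρ hIJ hJ K).1 hK).2⟩

/-- Since `I` is a compressor of both samples, the least size is the same for both. -/
lemma IsOptimal.isOptimal_of_subset (hρ : 0 < ρ) (h : IsOptimal φ ρ t x J' I) (hIJ : I ⊆ J)
    (hJ : J ⊆ J') {K : Finset ι} (hK : IsOptimal φ ρ t x J K) : IsOptimal φ ρ t x J' K :=
  ⟨((h.1.isCompressor_iff hρ hIJ hJ K).1 hK.1).2,
    fun L hL => (hK.2 I (h.of_subset hρ hIJ hJ).1).trans (h.2 L hL)⟩

lemma isCompressor_congr (h : ∀ i ∈ J, x i = y i) :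
    IsCompressor φ ρ t x J I ↔ IsCompressor φ ρ t y J I := by
  unfold IsCompressor
  refine and_congr_right fun hI => ?_
  rw [subsample_congr h, subsample_congr fun i hi => h i (hI hi)]
  refine and_congr_right fun _ => forall₂_congr fun i hi => ?_
  rw [h i hi]

lemma isOptimal_congr (h : ∀ i ∈ J, x i = y i) :
    IsOptimal φ ρ t x J I ↔ IsOptimal φ ρ t y J I := by
  simp only [IsOptimal, isCompressor_congr h]

variable [MeasurableSpace X] [Finite ι]

lemma measurableSet_isCompressor (hρ : 0 < ρ)
    (hφ : Measurable fun p : X × X => (inner ℝ (φ p.1) (φ p.2) : ℝ)) (J I : Finset ι) :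
    MeasurableSet {x : ι → X × ℝ | IsCompressor φ ρ t x J I} := by
  have hr (i : ι) : Measurable fun x : ι → X × ℝ => |solResidual φ ρ t (subsample x J) (x i)| :=
    ((measurable_solResidual hρ hφ J).comp (measurable_id.prodMk (measurable_pi_apply i))).abs
  refine measurableSet_setOfPred.2 (measurable_const.and
    ((measurableSet_setOfPred.1 (measurableSet_solution_eq hρ hφ I J)).and ?_))
  refine Measurable.forall fun i => measurable_const.imp (Measurable.and ?_ ?_)
  · exact (measurableSet_setOfPred.1 (measurableSet_lt measurable_const (hr i))).imp measurable_const
  · exact measurable_const.imp (measurableSet_setOfPred.1 (measurableSet_le measurable_const (hr i)))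

lemma measurableSet_isOptimal (hρ : 0 < ρ)
    (hφ : Measurable fun p : X × X => (inner ℝ (φ p.1) (φ p.2) : ℝ)) (J I : Finset ι) :
    MeasurableSet {x : ι → X × ℝ | IsOptimal φ ρ t x J I} :=
  measurableSet_setOfPred.2 <| (measurableSet_setOfPred.1 (measurableSet_isCompressor hρ hφ J I)).and <|
    Measurable.forall fun I' =>
      (measurableSet_setOfPred.1 (measurableSet_isCompressor hρ hφ J I')).imp measurable_const

end Compressor

end SVR

namespace SVR

/-! ### The risk as the probability of a misfit -/

section FitProb

open scoped ENNReal

variable {X H : Type*} [NormedAddCommGroup H] [InnerProductSpace ℝ H] {φ : X → H} {ρ t : ℝ}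
  {ι : Type*} [MeasurableSpace X] {x y : ι → X × ℝ} {I : Finset ι}

/-- The probability that a fresh example has residual at most `t` at the solution for the
subsample with index set `I`. -/
noncomputable def fitProb (D : Measure (X × ℝ)) (φ : X → H) (ρ t : ℝ) (I : Finset ι)
    (x : ι → X × ℝ) : ℝ≥0∞ :=
  D {z | |solResidual φ ρ t (subsample x I) z| ≤ t}

variable {D : Measure (X × ℝ)}

lemma fitProb_congr (h : ∀ i ∈ I, x i = y i) : fitProb D φ ρ t I x = fitProb D φ ρ t I y := by
  rw [fitProb, fitProb, subsample_congr h]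

variable [Finite ι]

lemma measurableSet_fit (hρ : 0 < ρ)
    (hφ : Measurable fun p : X × X => (inner ℝ (φ p.1) (φ p.2) : ℝ)) (I : Finset ι) :
    MeasurableSet {y : (ι → X × ℝ) × (X × ℝ) | |solResidual φ ρ t (subsample y.1 I) y.2| ≤ t} :=
  measurableSet_le (measurable_solResidual hρ hφ I).abs measurable_const

variable [IsProbabilityMeasure D]

lemma measurable_fitProb (hρ : 0 < ρ)
    (hφ : Measurable fun p : X × X => (inner ℝ (φ p.1) (φ p.2) : ℝ)) (I : Finset ι) :
    Measurable (fitProb D φ ρ t I) :=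
  measurable_measure_prodMk_left (measurableSet_fit hρ hφ I)

lemma risk_predictor (hρ : 0 < ρ)
    (hφ : Measurable fun p : X × X => (inner ℝ (φ p.1) (φ p.2) : ℝ)) (I : Finset ι)
    (x : ι → X × ℝ) :
    risk D t (predictor φ ρ t (subsample x I)) = 1 - (fitProb D φ ρ t I x).toReal := by
  have hm : MeasurableSet {z | |solResidual φ ρ t (subsample x I) z| ≤ t} :=
    measurable_prodMk_left (measurableSet_fit hρ hφ I)
  have h : {z : X × ℝ | loss t (predictor φ ρ t (subsample x I)) z = 1} =
      {z | |solResidual φ ρ t (subsample x I) z| ≤ t}ᶜ := by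
    ext z
    simp [loss, predictor, solResidual, residual, sub_sub]
    split_ifs <;> simp [*]
  rw [risk, h, probReal_compl_eq_one_sub hm]
  rfl

end FitProb

/-! ### Uniform weights on optimal compressors -/

section Weight

open scoped ENNReal

variable {X H : Type*} [NormedAddCommGroup H] [InnerProductSpace ℝ H] {φ : X → H} {ρ t : ℝ}
  {ι : Type*} [Fintype ι]

/-- The number of optimal compressors of the subsample with index set `J`. -/
noncomputable def optimalCount (φ : X → H) (ρ t : ℝ) (J : Finset ι) (x : ι → X × ℝ) : ℝ≥0∞ :=
  ∑ K : Finset ι, {x | IsOptimal φ ρ t x J K}.indicator 1 x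

/-- The weight of `I` under the uniform distribution on the optimal compressors of the subsample
with index set `J`. -/
noncomputable def weight (φ : X → H) (ρ t : ℝ) (J I : Finset ι) (x : ι → X × ℝ) : ℝ≥0∞ :=
  {x | IsOptimal φ ρ t x J I}.indicator 1 x * (optimalCount φ ρ t J x)⁻¹

variable {x y : ι → X × ℝ} {I J J' : Finset ι}

lemma weight_of_isOptimal (h : IsOptimal φ ρ t x J I) :
    weight φ ρ t J I x = (optimalCount φ ρ t J x)⁻¹ := by
  simp [weight, h]

lemma weight_of_not_isOptimal (h : ¬ IsOptimal φ ρ t x J I) : weight φ ρ t J I x = 0 := by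
  simp [weight, h]

lemma sum_weight (hρ : 0 < ρ) (φ : X → H) (t : ℝ) (J : Finset ι) (x : ι → X × ℝ) :
    ∑ I, weight φ ρ t J I x = 1 := by
  simp only [weight]
  rw [← Finset.sum_mul]
  refine ENNReal.mul_inv_cancel ?_ ?_
  · obtain ⟨I, hI⟩ := exists_isOptimal hρ φ t x J
    intro h
    have := (Finset.sum_eq_zero_iff.1 h) I (Finset.mem_univ I)
    simp [hI] at this
  · refine ENNReal.sum_ne_top.2 fun K _ => ?_
    by_cases hK : IsOptimal φ ρ t x J K <;> simp [hK]

lemma weight_congr (h : ∀ i ∈ J, x i = y i) : weight φ ρ t J I x = weight φ ρ t J I y := by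
  have hK (K : Finset ι) : {x | IsOptimal φ ρ t x J K}.indicator (1 : (ι → X × ℝ) → ℝ≥0∞) x =
      {x | IsOptimal φ ρ t x J K}.indicator 1 y := by
    have hiff : IsOptimal φ ρ t x J K ↔ IsOptimal φ ρ t y J K := isOptimal_congr h
    by_cases hy : IsOptimal φ ρ t y J K
    · simp [hy, hiff.2 hy]
    · simp [hy, mt hiff.1 hy]
  simp only [weight, optimalCount, hK]

/-- When `I` is optimal for `J'`, shrinking to `J` only loses competitors, so the count decreases
and its reciprocal grows. -/
lemma weight_le_of_subset (hρ : 0 < ρ) (hIJ : I ⊆ J) (hJ : J ⊆ J') (x : ι → X × ℝ) :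
    weight φ ρ t J' I x ≤ weight φ ρ t J I x := by
  by_cases h : IsOptimal φ ρ t x J' I
  · rw [weight_of_isOptimal h, weight_of_isOptimal (h.of_subset hρ hIJ hJ)]
    refine ENNReal.inv_le_inv.2 (Finset.sum_le_sum fun K _ => ?_)
    by_cases hK : IsOptimal φ ρ t x J K
    · simp [hK, h.isOptimal_of_subset hρ hIJ hJ hK]
    · simp [hK]
  · simp [weight_of_not_isOptimal h]

variable [MeasurableSpace X]

lemma measurable_weight (hρ : 0 < ρ)
    (hφ : Measurable fun p : X × X => (inner ℝ (φ p.1) (φ p.2) : ℝ)) (J I : Finset ι) :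
    Measurable (weight φ ρ t J I) :=
  (measurable_one.indicator (measurableSet_isOptimal hρ hφ J I)).mul
    (Finset.measurable_sum _ fun K _ =>
      measurable_one.indicator (measurableSet_isOptimal hρ hφ J K)).inv

variable {D : Measure (X × ℝ)} [IsProbabilityMeasure D]

/-- Adding an example to a sample multiplies the weights by at most the probability that the
example is fitted. -/
lemma lintegral_weight_insert_le [DecidableEq ι] (hρ : 0 < ρ)
    (hφ : Measurable fun p : X × X => (inner ℝ (φ p.1) (φ p.2) : ℝ)) {j : ι} (hIJ : I ⊆ J)
    (hj : j ∉ J) {h : ℝ≥0∞ → ℝ≥0∞} (hh : Measurable h) :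
    ∫⁻ x, weight φ ρ t (insert j J) I x * h (fitProb D φ ρ t I x) ∂Measure.pi (fun _ => D) ≤
      ∫⁻ x, weight φ ρ t J I x * (h (fitProb D φ ρ t I x) * fitProb D φ ρ t I x)
        ∂Measure.pi (fun _ => D) := by
  set A : Set (ι → X × ℝ) := {x | |solResidual φ ρ t (subsample x I) (x j)| ≤ t} with hA
  have hAm : MeasurableSet A :=
    (measurable_id.prodMk (measurable_pi_apply j)) (measurableSet_fit hρ hφ I)
  have ha := measurable_fitProb (D := D) (t := t) hρ hφ I
  have hw := measurable_weight (t := t) hρ hφ J I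
  calc _ ≤ ∫⁻ x, weight φ ρ t J I x * h (fitProb D φ ρ t I x) * A.indicator 1 x
        ∂Measure.pi (fun _ => D) := by
        refine lintegral_mono fun x => ?_
        by_cases hopt : IsOptimal φ ρ t x (insert j J) I
        · have hx : x ∈ A :=
            hopt.1.abs_solResidual_le (Finset.mem_insert_self j J) fun hjI => hj (hIJ hjI)
          simp only [Set.indicator_of_mem hx, Pi.one_apply, mul_one]
          gcongr
          exact weight_le_of_subset hρ hIJ (Finset.subset_insert j J) x
        · simp [weight_of_not_isOptimal hopt]
    _ = _ := by
        -- Integrate over position `j` first: the weight and `fitProb` depend only on positions in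
        -- `J`, so the indicator alone is averaged.
        refine lintegral_eq_of_lmarginal_eq {j}
          ((hw.mul (hh.comp ha)).mul (measurable_one.indicator hAm))
          (hw.mul ((hh.comp ha).mul ha)) ?_
        rw [lmarginal_singleton, lmarginal_singleton]
        funext x
        have hx (v : X × ℝ) (i : ι) (hi : i ∈ J) : Function.update x j v i = x i :=
          Function.update_of_ne (ne_of_mem_of_not_mem hi hj) _ _
        have h1 (v) : weight φ ρ t J I (Function.update x j v) = weight φ ρ t J I x :=
          weight_congr (hx v)
        have h2 (v) : fitProb D φ ρ t I (Function.update x j v) = fitProb D φ ρ t I x :=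
          fitProb_congr fun i hi => hx v i (hIJ hi)
        have h3 (v) : A.indicator (1 : (ι → X × ℝ) → ℝ≥0∞) (Function.update x j v) =
            {z | |solResidual φ ρ t (subsample x I) z| ≤ t}.indicator 1 v := by
          simp only [Set.indicator, hA, Set.mem_ofPred_eq, Function.update_self,
            subsample_congr fun i hi => hx v i (hIJ hi), Pi.one_apply]
        have hm : MeasurableSet {z | |solResidual φ ρ t (subsample x I) z| ≤ t} :=
          measurable_prodMk_left (measurableSet_fit hρ hφ I)
        simp only [h1, h2, h3]
        rw [lintegral_const_mul _ (measurable_one.indicator hm), lintegral_indicator_one hm,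
          lintegral_const, measure_univ, mul_one, mul_assoc]
        rfl

/-- Each step of the induction absorbs one factor `fitProb` into `h`, which is why `h` is arbitrary.
-/
lemma lintegral_weight_union_le [DecidableEq ι] (hρ : 0 < ρ)
    (hφ : Measurable fun p : X × X => (inner ℝ (φ p.1) (φ p.2) : ℝ)) (hIJ : I ⊆ J)
    {A : Finset ι} (hA : Disjoint A J) {h : ℝ≥0∞ → ℝ≥0∞} (hh : Measurable h) :
    ∫⁻ x, weight φ ρ t (A ∪ J) I x * h (fitProb D φ ρ t I x) ∂Measure.pi (fun _ => D) ≤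
      ∫⁻ x, weight φ ρ t J I x * (h (fitProb D φ ρ t I x) * fitProb D φ ρ t I x ^ A.card)
        ∂Measure.pi (fun _ => D) := by
  induction A using Finset.induction_on generalizing h with
  | empty => simp
  | insert j A hj ih =>
    rw [Finset.disjoint_insert_left] at hA
    rw [Finset.insert_union]
    refine (lintegral_weight_insert_le hρ hφ (hIJ.trans Finset.subset_union_right)
      (by simp [hj, hA.1]) hh).trans ?_
    refine (ih hA.2 (hh.mul measurable_id)).trans_eq ?_
    simp [Finset.card_insert_of_notMem hj, pow_succ', mul_assoc]

lemma lintegral_weight_univ_mul_inv_le (hρ : 0 < ρ)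
    (hφ : Measurable fun p : X × X => (inner ℝ (φ p.1) (φ p.2) : ℝ)) (hIJ : I ⊆ J)
    {s : Set ℝ≥0∞} (hs : MeasurableSet s) :
    ∫⁻ x, weight φ ρ t Finset.univ I x * s.indicator
        (fun a => (a ^ (Fintype.card ι - J.card))⁻¹) (fitProb D φ ρ t I x)
          ∂Measure.pi (fun _ => D) ≤
      ∫⁻ x, weight φ ρ t J I x ∂Measure.pi (fun _ => D) := by
  classical
  have hcard : Jᶜ.card = Fintype.card ι - J.card := Finset.card_compl J
  have hm : Measurable (s.indicator fun a : ℝ≥0∞ => (a ^ Jᶜ.card)⁻¹) :=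
    (measurable_id.pow_const _).inv.indicator hs
  have h := lintegral_weight_union_le (D := D) (t := t) hρ hφ hIJ
    (disjoint_compl_left : Disjoint Jᶜ J) hm
  rw [Finset.union_comm, Finset.union_compl] at h
  rw [← hcard]
  refine h.trans (lintegral_mono fun x => mul_le_of_le_one_right' ?_)
  by_cases hx : fitProb D φ ρ t I x ∈ s
  · rw [Set.indicator_of_mem hx, mul_comm]
    -- The inequality also covers `fitProb = 0`, where the product is 0.
    exact ENNReal.mul_inv_le_one _
  · simp [Set.indicator_of_notMem hx]

end Weight

/-! ### The equation defining the thresholds -/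

section Threshold

open scoped ENNReal

variable {N k : ℕ} {δ : ℝ}

lemma exists_Psi_eq_one (hk : k < N) (hδ : δ ∈ Set.Ioo (0 : ℝ) 1) :
    ∃ α ∈ Set.Ioo (0 : ℝ) 1, Psi N δ k α = 1 := by
  have hN : (0 : ℝ) < N := by exact_mod_cast (Nat.zero_le k).trans_lt hk
  have hchoose : (0 : ℝ) < N.choose k := by exact_mod_cast Nat.choose_pos hk.le
  have hle (m : ℕ) (hm : m ∈ Finset.Ico k N) : (m.choose k : ℝ) / N.choose k ≤ 1 := by
    rw [div_le_one hchoose]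
    exact_mod_cast Nat.choose_le_choose k (Finset.mem_Ico.1 hm).2.le
  have hmem : N - 1 ∈ Finset.Ico k N := Finset.mem_Ico.2 (by omega)
  -- The term `m = N - 1` of `Ψ` is `c / (1 - α)`, which reaches 1 at `α = 1 - c`; at `α = 0` the
  -- whole sum is at most `δ`. The intermediate value theorem applies between the two.
  set c : ℝ := δ / N * (((N - 1).choose k : ℝ) / N.choose k) with hc
  have hδN : δ / N < 1 := by
    rw [div_lt_one hN]
    have : (1 : ℝ) ≤ N := by exact_mod_cast (Nat.zero_le k).trans_lt hk
    linarith [hδ.2]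
  have hδN0 : 0 < δ / N := div_pos hδ.1 hN
  have hc0 : 0 < c := by
    have : (0 : ℝ) < (N - 1).choose k := by exact_mod_cast Nat.choose_pos (by omega)
    positivity
  have hc1 : c < 1 := (mul_le_of_le_one_right hδN0.le (hle _ hmem)).trans_lt hδN
  have h0 : Psi N δ k 0 < 1 := by
    have : Psi N δ k 0 ≤ δ := by
      have h1 : ∑ m ∈ Finset.Ico k N, (m.choose k : ℝ) / N.choose k * ((1 - (0 : ℝ)) ^ (N - m))⁻¹ ≤
          N := by
        refine (Finset.sum_le_card_nsmul _ _ 1 fun m hm => by simpa using hle m hm).trans ?_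
        simp
      calc Psi N δ k 0 ≤ δ / N * N := mul_le_mul_of_nonneg_left h1 hδN0.le
        _ = δ := div_mul_cancel₀ _ hN.ne'
    exact this.trans_lt hδ.2
  have h1 : 1 ≤ Psi N δ k (1 - c) := by
    have h2 : ((N - 1).choose k : ℝ) / N.choose k * ((1 - (1 - c)) ^ (N - (N - 1)))⁻¹ ≤
        ∑ m ∈ Finset.Ico k N, (m.choose k : ℝ) / N.choose k * ((1 - (1 - c)) ^ (N - m))⁻¹ :=
      Finset.single_le_sum (f := fun m : ℕ =>
        (m.choose k : ℝ) / N.choose k * ((1 - (1 - c)) ^ (N - m))⁻¹)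
        (fun m _ => by rw [sub_sub_cancel]; positivity) hmem
    have h3 := mul_le_mul_of_nonneg_left h2 hδN0.le
    rw [show N - (N - 1) = 1 by omega, sub_sub_cancel, pow_one, ← mul_assoc, ← hc,
      mul_inv_cancel₀ hc0.ne'] at h3
    rwa [Psi, sub_sub_cancel]
  have hcont : ContinuousOn (Psi N δ k) (Set.Icc 0 (1 - c)) := by
    unfold Psi
    refine continuousOn_const.mul (continuousOn_finsetSum _ fun m _ => continuousOn_const.mul ?_)
    refine ContinuousOn.inv₀ (by fun_prop) fun α hα => ?_
    have : 0 < 1 - α := by linarith [hα.2]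
    positivity
  obtain ⟨α, hα, hαeq⟩ := intermediate_value_Icc (by linarith) hcont ⟨h0.le, h1⟩
  refine ⟨α, ⟨lt_of_le_of_ne hα.1 ?_, by linarith [hα.2]⟩, hαeq⟩
  rintro rfl
  exact h0.ne hαeq

lemma one_le_Psi_of_eps_lt (hk : k < N) (hδ : δ ∈ Set.Ioo (0 : ℝ) 1) {α : ℝ}
    (h : eps N δ k < α) (hα : α < 1) : 1 ≤ Psi N δ k α := by
  rw [eps, if_pos hk] at h
  obtain ⟨-, heq⟩ := Classical.epsilon_spec (p := fun α : ℝ => α ∈ Set.Ioo 0 1 ∧ Psi N δ k α = 1)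
    (exists_Psi_eq_one hk hδ)
  rw [← heq]
  unfold Psi
  have h0 : 0 < 1 - α := by linarith
  have := hδ.1
  gcongr
  exact h.le

/-- Monotonicity of `Ψ` handles risk below 1. Risk 1 means `a = 0`, where the term `m = k` is
infinite. -/
lemma one_le_sum_of_eps_lt (hk : k < N) (hδ : δ ∈ Set.Ioo (0 : ℝ) 1) {a : ℝ≥0∞} (ha : a ≠ ∞)
    (h : eps N δ k < 1 - a.toReal) :
    1 ≤ ∑ m ∈ Finset.Ico k N,
      ENNReal.ofReal (δ / N * (m.choose k / N.choose k)) * (a ^ (N - m))⁻¹ := by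
  have hN : (0 : ℝ) < N := by exact_mod_cast (Nat.zero_le k).trans_lt hk
  have hchoose : (0 : ℝ) < N.choose k := by exact_mod_cast Nat.choose_pos hk.le
  have hδ0 := hδ.1
  rcases eq_or_ne a 0 with rfl | ha0
  · have hpos : 0 < ENNReal.ofReal (δ / N * (k.choose k / N.choose k)) := by
      rw [ENNReal.ofReal_pos, Nat.choose_self, Nat.cast_one]
      positivity
    have hterm : ENNReal.ofReal (δ / N * (k.choose k / N.choose k)) * ((0 : ℝ≥0∞) ^ (N - k))⁻¹ =
        ∞ := by
      rw [zero_pow (by omega), ENNReal.inv_zero, ENNReal.mul_top hpos.ne']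
    refine le_top.trans (hterm.ge.trans ?_)
    exact Finset.single_le_sum (f := fun m : ℕ =>
      ENNReal.ofReal (δ / N * (m.choose k / N.choose k)) * ((0 : ℝ≥0∞) ^ (N - m))⁻¹)
      (fun _ _ => zero_le) (Finset.mem_Ico.2 ⟨le_rfl, hk⟩)
  · have hpos := ENNReal.toReal_pos ha0 ha
    have h1 := ENNReal.ofReal_le_ofReal (one_le_Psi_of_eps_lt hk hδ h (by linarith))
    rw [ENNReal.ofReal_one, Psi, Finset.mul_sum, sub_sub_cancel,
      ENNReal.ofReal_sum_of_nonneg fun m _ => by positivity] at h1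
    refine h1.trans_eq (Finset.sum_congr rfl fun m _ => ?_)
    rw [← mul_assoc, ENNReal.ofReal_mul (by positivity), ENNReal.ofReal_inv_of_pos (by positivity),
      ENNReal.ofReal_pow hpos.le, ENNReal.ofReal_toReal ha]

/-- This rewrites a coefficient of `Ψ` as an average over `m`-sets: the last factor counts those
containing a given `k`-set. -/
lemma ofReal_choose_ratio (hδ : 0 ≤ δ) {m : ℕ} (hkm : k ≤ m) (hm : m ≤ N) :
    ENNReal.ofReal (δ / N * (m.choose k / N.choose k)) =
      ENNReal.ofReal (δ / N) * (N.choose m : ℝ≥0∞)⁻¹ * ((N - k).choose (m - k) : ℝ≥0∞) := by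
  have h1 : (0 : ℝ) < N.choose k := by exact_mod_cast Nat.choose_pos (hkm.trans hm)
  have h2 : (0 : ℝ) < N.choose m := by exact_mod_cast Nat.choose_pos hm
  have h3 : (N.choose m : ℝ) * m.choose k = N.choose k * (N - k).choose (m - k) := by
    exact_mod_cast Nat.choose_mul hkm
  have h4 : δ / N * (m.choose k / N.choose k : ℝ) =
      δ / N * (N.choose m : ℝ)⁻¹ * ((N - k).choose (m - k) : ℝ) := by
    rw [mul_assoc]
    congr 1
    field_simp
    linarith
  rw [h4, ENNReal.ofReal_mul (by positivity), ENNReal.ofReal_mul (by positivity),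
    ENNReal.ofReal_inv_of_pos h2, ENNReal.ofReal_natCast, ENNReal.ofReal_natCast]

end Threshold

end SVR

namespace SVR

/-! ### Summing the weights on the bad event -/

section Bound

open scoped ENNReal

lemma choose_le_card_filter_subset {ι : Type*} [Fintype ι] [DecidableEq ι] (I : Finset ι) {m : ℕ}
    (hm : I.card ≤ m) : (Fintype.card ι - I.card).choose (m - I.card) ≤
      ((Finset.powersetCard m (Finset.univ : Finset ι)).filter fun J => I ⊆ J).card := by
  rw [← Finset.card_compl, ← Finset.card_powersetCard]
  have hdisj {T : Finset ι} (hT : T ∈ Finset.powersetCard (m - I.card) Iᶜ) : Disjoint I T :=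
    (disjoint_compl_right (a := I)).mono_right (Finset.mem_powersetCard.1 hT).1
  refine Finset.card_le_card_of_injOn (fun T => I ∪ T) (fun T hT => ?_) fun T hT T' hT' h => ?_
  · rw [Finset.mem_coe, Finset.mem_filter, Finset.mem_powersetCard]
    refine ⟨⟨Finset.subset_univ _, ?_⟩, Finset.subset_union_left⟩
    rw [Finset.card_union_of_disjoint (hdisj hT), (Finset.mem_powersetCard.1 hT).2]
    omega
  · have h' := congrArg (· \ I) h
    simpa [Finset.union_sdiff_cancel_left (hdisj hT),
      Finset.union_sdiff_cancel_left (hdisj hT')] using h'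

lemma measurableSet_eps_lt (N : ℕ) (δ : ℝ) (k : ℕ) :
    MeasurableSet {a : ℝ≥0∞ | eps N δ k < 1 - a.toReal} :=
  measurableSet_lt measurable_const (measurable_const.sub ENNReal.measurable_toReal)

variable {X H : Type*} [NormedAddCommGroup H] [InnerProductSpace ℝ H] {φ : X → H} {ρ t : ℝ}
  {ι : Type*} [Fintype ι] [MeasurableSpace X] {D : Measure (X × ℝ)} [IsProbabilityMeasure D]
  {δ : ℝ}

/-- The weight of `I` for the whole sample, restricted to the event that the risk exceeds the
threshold for compressed size `I.card`. -/
noncomputable def excessWeight (D : Measure (X × ℝ)) (φ : X → H) (ρ t δ : ℝ) (I : Finset ι)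
    (x : ι → X × ℝ) : ℝ≥0∞ :=
  weight φ ρ t Finset.univ I x *
    {a : ℝ≥0∞ | eps (Fintype.card ι) δ I.card < 1 - a.toReal}.indicator 1 (fitProb D φ ρ t I x)

lemma measurable_excessWeight (hρ : 0 < ρ)
    (hφ : Measurable fun p : X × X => (inner ℝ (φ p.1) (φ p.2) : ℝ)) (δ : ℝ) (I : Finset ι) :
    Measurable (excessWeight D φ ρ t δ I) :=
  (measurable_weight hρ hφ _ I).mul ((measurable_one.indicator (measurableSet_eps_lt _ δ _)).comp
    (measurable_fitProb hρ hφ I))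

lemma lintegral_excessWeight_le [DecidableEq ι] (hρ : 0 < ρ)
    (hφ : Measurable fun p : X × X => (inner ℝ (φ p.1) (φ p.2) : ℝ))
    (hδ : δ ∈ Set.Ioo (0 : ℝ) 1) (I : Finset ι) :
    ∫⁻ x, excessWeight D φ ρ t δ I x ∂Measure.pi (fun _ => D) ≤
      ∑ m ∈ Finset.range (Fintype.card ι),
        ENNReal.ofReal (δ / Fintype.card ι) * ((Fintype.card ι).choose m : ℝ≥0∞)⁻¹ *
          ∑ J ∈ Finset.powersetCard m Finset.univ with I ⊆ J,
            ∫⁻ x, weight φ ρ t J I x ∂Measure.pi (fun _ => D) := by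
  set N := Fintype.card ι with hN
  set k := I.card with hk
  set s : Set ℝ≥0∞ := {a | eps N δ k < 1 - a.toReal} with hs
  have hsm : MeasurableSet s := measurableSet_eps_lt N δ k
  have hfit (x : ι → X × ℝ) : fitProb D φ ρ t I x ≠ ∞ := measure_ne_top _ _
  rcases (Finset.card_le_univ I).lt_or_eq with hkN | hkN
  · have hg (m : ℕ) : Measurable fun x : ι → X × ℝ => weight φ ρ t Finset.univ I x *
        s.indicator (fun a => (a ^ (N - m))⁻¹) (fitProb D φ ρ t I x) :=
      (measurable_weight hρ hφ _ I).mul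
        (((measurable_id.pow_const _).inv.indicator hsm).comp (measurable_fitProb hρ hφ I))
    calc ∫⁻ x, excessWeight D φ ρ t δ I x ∂Measure.pi (fun _ => D)
        ≤ ∫⁻ x, ∑ m ∈ Finset.Ico k N, ENNReal.ofReal (δ / N * (m.choose k / N.choose k)) *
            (weight φ ρ t Finset.univ I x *
              s.indicator (fun a => (a ^ (N - m))⁻¹) (fitProb D φ ρ t I x))
            ∂Measure.pi (fun _ => D) := by
          refine lintegral_mono fun x => ?_
          by_cases hx : fitProb D φ ρ t I x ∈ s
          · simp only [excessWeight, ← hN, ← hk, ← hs, Set.indicator_of_mem hx, Pi.one_apply]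
            simp only [mul_left_comm _ (weight φ ρ t Finset.univ I x)]
            rw [← Finset.mul_sum]
            gcongr
            exact one_le_sum_of_eps_lt hkN hδ (hfit x) hx
          · simp [excessWeight, ← hN, ← hk, ← hs, Set.indicator_of_notMem hx]
      _ = ∑ m ∈ Finset.Ico k N, ENNReal.ofReal (δ / N * (m.choose k / N.choose k)) *
            ∫⁻ x, weight φ ρ t Finset.univ I x *
              s.indicator (fun a => (a ^ (N - m))⁻¹) (fitProb D φ ρ t I x)
              ∂Measure.pi (fun _ => D) := by
          rw [lintegral_finsetSum _ fun m _ => (hg m).const_mul _]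
          exact Finset.sum_congr rfl fun m _ => lintegral_const_mul _ (hg m)
      _ ≤ ∑ m ∈ Finset.Ico k N, ENNReal.ofReal (δ / N) * (N.choose m : ℝ≥0∞)⁻¹ *
            ∑ J ∈ Finset.powersetCard m Finset.univ with I ⊆ J,
              ∫⁻ x, weight φ ρ t J I x ∂Measure.pi (fun _ => D) := by
          refine Finset.sum_le_sum fun m hm => ?_
          obtain ⟨hkm, hmN⟩ := Finset.mem_Ico.1 hm
          rw [ofReal_choose_ratio hδ.1.le hkm hmN.le, mul_assoc]
          gcongr
          -- Spend one copy of the integral on each `m`-set `J ⊇ I`, bounding it by the weight of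
          -- `I` for that `J`.
          refine (mul_le_mul_left (Nat.cast_le.2 (choose_le_card_filter_subset I hkm)) _).trans ?_
          rw [← nsmul_eq_mul]
          refine Finset.card_nsmul_le_sum _ _ _ fun J hJ => ?_
          obtain ⟨hJm, hIJ⟩ := Finset.mem_filter.1 hJ
          have h := lintegral_weight_univ_mul_inv_le (D := D) (t := t) hρ hφ hIJ hsm
          rwa [(Finset.mem_powersetCard.1 hJm).2] at h
      _ ≤ _ := Finset.sum_le_sum_of_subset fun m hm =>
          Finset.mem_range.2 (Finset.mem_Ico.1 hm).2
  -- If `I` is the whole index set, the threshold is 1 and the risk cannot exceed it.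
  · have h0 (x : ι → X × ℝ) : excessWeight D φ ρ t δ I x = 0 := by
      have hx : fitProb D φ ρ t I x ∉ s := by
        simp only [hs, Set.mem_ofPred_eq, not_lt, eps, hkN, hk, hN, lt_irrefl, if_false]
        linarith [ENNReal.toReal_nonneg (a := fitProb D φ ρ t I x)]
      rw [excessWeight, ← hN, ← hk, ← hs, Set.indicator_of_notMem hx, mul_zero]
    simp [h0]

lemma sum_lintegral_excessWeight_le (hρ : 0 < ρ)
    (hφ : Measurable fun p : X × X => (inner ℝ (φ p.1) (φ p.2) : ℝ))
    (hδ : δ ∈ Set.Ioo (0 : ℝ) 1) :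
    ∑ I : Finset ι, ∫⁻ x, excessWeight D φ ρ t δ I x ∂Measure.pi (fun _ => D) ≤
      ENNReal.ofReal δ := by
  classical
  set N := Fintype.card ι with hN
  calc _ ≤ ∑ I : Finset ι, ∑ m ∈ Finset.range N,
        ENNReal.ofReal (δ / N) * (N.choose m : ℝ≥0∞)⁻¹ *
          ∑ J ∈ Finset.powersetCard m Finset.univ with I ⊆ J,
            ∫⁻ x, weight φ ρ t J I x ∂Measure.pi (fun _ => D) :=
        Finset.sum_le_sum fun I _ => lintegral_excessWeight_le hρ hφ hδ I
    _ ≤ ∑ m ∈ Finset.range N, ENNReal.ofReal (δ / N) := by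
        rw [Finset.sum_comm]
        refine Finset.sum_le_sum fun m hm => ?_
        rw [← Finset.mul_sum, mul_assoc]
        refine mul_le_of_le_one_right' ?_
        have h1 : ∑ I : Finset ι, ∑ J ∈ Finset.powersetCard m Finset.univ with I ⊆ J,
            ∫⁻ x, weight φ ρ t J I x ∂Measure.pi (fun _ => D) ≤ N.choose m := by
          calc _ ≤ ∑ I : Finset ι, ∑ J ∈ Finset.powersetCard m Finset.univ,
                ∫⁻ x, weight φ ρ t J I x ∂Measure.pi (fun _ => D) :=
                Finset.sum_le_sum fun I _ => Finset.sum_le_sum_of_subset (Finset.filter_subset _ _)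
            -- For each `J` the weights form a probability distribution over `I`.
            _ = ∑ J ∈ Finset.powersetCard m (Finset.univ : Finset ι), 1 := by
                rw [Finset.sum_comm]
                refine Finset.sum_congr rfl fun J _ => ?_
                rw [← lintegral_finsetSum _ fun I _ => measurable_weight hρ hφ J I]
                simp [sum_weight hρ]
            _ = N.choose m := by simp [hN]
        rw [mul_comm]
        exact (mul_le_mul_left h1 _).trans (ENNReal.mul_inv_le_one _)
    _ ≤ ENNReal.ofReal δ := by
        rw [Finset.sum_const, Finset.card_range, ← ENNReal.ofReal_nsmul, nsmul_eq_mul]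
        refine ENNReal.ofReal_le_ofReal ?_
        rcases eq_or_ne (N : ℝ) 0 with h | h
        · rw [h, zero_mul]
          exact hδ.1.le
        · rw [mul_div_cancel₀ _ h]

/-- All optimal sets have the same size and the same solution, so on the bad event each keeps its
full weight. -/
lemma one_le_sum_excessWeight [LinearOrder X] (hρ : 0 < ρ)
    (hφ : Measurable fun p : X × X => (inner ℝ (φ p.1) (φ p.2) : ℝ)) {x : ι → X × ℝ}
    (h : eps (Fintype.card ι) δ (compression φ ρ t (subsample x Finset.univ)).card <
      risk D t (predictor φ ρ t (subsample x Finset.univ))) :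
    1 ≤ ∑ I : Finset ι, excessWeight D φ ρ t δ I x := by
  rw [← sum_weight hρ φ t Finset.univ x]
  refine Finset.sum_le_sum fun I _ => ?_
  by_cases hI : IsOptimal φ ρ t x Finset.univ I
  · have hfit : fitProb D φ ρ t I x = fitProb D φ ρ t Finset.univ x := by
      simp only [fitProb, solResidual, hI.1.2.1]
    rw [hI.card_compression hρ, risk_predictor hρ hφ, ← hfit] at h
    have hmem : fitProb D φ ρ t I x ∈
        {a : ℝ≥0∞ | eps (Fintype.card ι) δ I.card < 1 - a.toReal} := h
    rw [excessWeight, Set.indicator_of_mem hmem, Pi.one_apply, mul_one]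
  · simp [weight_of_not_isOptimal hI]

end Bound

end SVR

theorem mainTheorem9 {X H Ω : Type*} [MeasurableSpace X] [LinearOrder X]
    [NormedAddCommGroup H] [InnerProductSpace ℝ H] [CompleteSpace H]
    (φ : X → H) (hφ : Measurable fun p : X × X => inner ℝ (φ p.1) (φ p.2))
    (ρ : ℝ) (hρ : 0 < ρ) (t : ℝ) (ht : 0 ≤ t)
    [MeasurableSpace Ω] (P : Measure Ω) [IsProbabilityMeasure P]
    (D : Measure (X × ℝ)) [IsProbabilityMeasure D]
    (N : ℕ) (z : Fin N → Ω → X × ℝ) (hz : ∀ i, Measurable (z i))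
    (hindep : iIndepFun z P) (hlaw : ∀ i, P.map (z i) = D)
    (δ : ℝ) (hδ : δ ∈ Set.Ioo (0 : ℝ) 1) :
    let S : Ω → Multiset (X × ℝ) := fun ω => Finset.univ.val.map fun i => z i ω
    P {ω | SVR.eps N δ (SVR.compression φ ρ t (S ω)).card <
        SVR.risk D t (SVR.predictor φ ρ t (S ω))} ≤ ENNReal.ofReal δ := by
  intro S
  let W : (Fin N → X × ℝ) → ENNReal := fun x => ∑ I, SVR.excessWeight D φ ρ t δ I x
  have hW (I : Finset (Fin N)) : Measurable (SVR.excessWeight D φ ρ t δ I) :=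
    SVR.measurable_excessWeight hρ hφ δ I
  have hWm : Measurable W := Finset.measurable_sum _ fun I _ => hW I
  have hzm : Measurable fun ω i => z i ω := measurable_pi_iff.2 hz
  have hmap : P.map (fun ω i => z i ω) = Measure.pi fun _ => D := by
    rw [hindep.map_fun_eq_pi_map fun i => (hz i).aemeasurable]
    simp only [hlaw]
  calc P {ω | SVR.eps N δ (SVR.compression φ ρ t (S ω)).card <
          SVR.risk D t (SVR.predictor φ ρ t (S ω))}
      ≤ P {ω | 1 ≤ W fun i => z i ω} := by
        refine measure_mono fun ω hω => ?_
        refine SVR.one_le_sum_excessWeight hρ hφ ?_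
        rw [Fintype.card_fin]
        exact hω
    -- Markov's inequality at level 1.
    _ ≤ ∫⁻ ω, W fun i => z i ω ∂P := by
        simpa using mul_meas_ge_le_lintegral (hWm.comp hzm) 1
    _ = ∑ I, ∫⁻ x, SVR.excessWeight D φ ρ t δ I x ∂Measure.pi (fun _ : Fin N => D) := by
        rw [← lintegral_map hWm hzm, hmap, lintegral_finsetSum _ fun I _ => hW I]
    _ ≤ ENNReal.ofReal δ := SVR.sum_lintegral_excessWeight_le hρ hφ hδ
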